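/- Let $\mathcal C$ be a non-empty set of finite non-empty sets, and let $\mathcal T=\mathcal T(\mathcal C)$ be the category of all maps $\alpha:A\to B$ with $A,B\in\mathcal C$, composed from left to right; a morphism carries its domain $A$ and codomain $B$. Let $\xi\in\{2,3,\ldots,\omega\}$ be the least strict upper bound of $\{|A|:A\in\mathcal C\}$. For $1\le r<\xi$ let $I_r=\{\alpha\in\mathcal T:\operatorname{rank}(\alpha)\le r\}$, where $\operatorname{rank}(\alpha)=|\operatorname{im}(\alpha)|$, and let $I_\omega=\mathcal T$ if $\xi=\omega$; these are ideals of $\mathcal T$, regarded as partial semigroups (categories possibly lacking some identities). A congruence on a partial semigroup $S$ is an equivalence relation on $S$ that relates only elements of a common hom-set and is compatible with the partial product on the left and on the right; $\operatorname{Cong}(S)$ is the lattice of all congruences on $S$ ordered by inclusion, $\Delta_S$ is the equality relation, and $\nabla_S$ is the relation of belonging to a common hom-set. $\operatorname{Eq}(A)$ is the lattice of equivalence relations on $A$. For each $1\le q<\xi$ fix $X_q\in\mathcal C$ with $n_q=|X_q|\ge q$ and identify $X_q$ with $\{1,\ldots,n_q\}$. For $\pi$ in the symmetric group $\mathcal S_q$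 let $\pi^\natural:X_q\to X_q$ be given by $k\mapsto k\pi$ for $k<q$ and $k\mapsto q\pi$ for $k\ge q$, and for $N\trianglelefteq\mathcal S_q$ let $N^\natural=\{\pi^\natural:\pi\in N\}$. For $1\le q<r$ and $N\trianglelefteq\mathcal S_{q+1}$ let $$R_{I_q,N^\natural}=\{(\alpha,\beta)\in\nabla_{I_r}:\alpha=\beta\text{ or }\alpha,\beta\in I_q\}\cup\{(axb,ayb): x,y\in N^\natural,\ a,b\in I_r^1,\ axb,ayb\in D_{q+1}\},$$ where $I_r^1$ is $I_r$ with identities adjoined and $D_{q+1}$, the set of maps of rank $q+1$, is the $\mathscr J$-class of $I_r$ containing $N^\natural$. (i) $I_1$ is the minimum ideal of $\mathcal T$, and it is a partial rectangular band: for some families of non-empty sets $(X'_A)_{A\in\mathcal C}$ and $(Y'_A)_{A\in\mathcal C}$ it is isomorphic, over the same objects, to $\bigsqcup_A X'_A\times\bigsqcup_A Y'_A$ with hom-sets $X'_A\times Y'_B$ and product $(x_1,y_1)(x_2,y_2)=(x_1,y_2)$. Under this isomorphism the congruences on $I_1$ are exactly the relations that relate $(x_1,y_1),(x_2,y_2)\in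 X'_A\times Y'_B$ if and only if $(x_1,x_2)\in\varepsilon_1^A$ and $(y_1,y_2)\in\varepsilon_2^B$ (for all $A,B\in\mathcal C$), for families of equivalences $\varepsilon_1^A\in\operatorname{Eq}(X'_A)$ and $\varepsilon_2^A\in\operatorname{Eq}(Y'_A)$, and this correspondence is a lattice isomorphism $\prod_A\operatorname{Eq}(X'_A)\times\prod_A\operatorname{Eq}(Y'_A)\cong\operatorname{Cong}(I_1)$. In particular, $$\operatorname{Cong}(I_1)\cong\prod_{A\in\mathcal C}\operatorname{Eq}(A).$$ (ii) For $2\le r<\xi$, and also for $r=\omega$ if $\xi=\omega$, $$\operatorname{Cong}(I_r)=\{\Delta_{I_r}\}\cup\{R_{I_q,N^\natural}:1\le q<r,\ N\trianglelefteq\mathcal S_{q+1}\}\cup\{\nabla_{I_r}\},$$ and this is a chain under inclusion. -/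

import Mathlib

universe u v w

/-- A partial semigroup with objects `C` and morphisms `S`: the product `x · y` is defined exactly
when `rng x = dom y`. -/
structure PartialSemigroup (C : Type u) (S : Type v) where
  dom : S → C
  rng : S → C
  mul : ∀ x y : S, rng x = dom y → S
  dom_mul : ∀ (x y : S) (h : rng x = dom y), dom (mul x y h) = dom x
  rng_mul : ∀ (x y : S) (h : rng x = dom y), rng (mul x y h) = rng y
  mul_assoc : ∀ (x y z : S) (hxy : rng x = dom y) (hyz : rng y = dom z),
    mul (mul x y hxy) z ((rng_mul x y hxy).trans hyz) =
      mul x (mul y z hyz) (hxy.trans (dom_mul y z hyz).symm)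

namespace PartialSemigroup

section General

variable {C : Type u} {S : Type v} (P : PartialSemigroup C S)

/-- `x ∼ y`: the morphisms `x` and `y` belong to a common hom-set.  As a relation, this is the
universal congruence. -/
def Nab (x y : S) : Prop := P.dom x = P.dom y ∧ P.rng x = P.rng y

/-- Congruences on a partial semigroup. -/
structure IsCongruence (σ : S → S → Prop) : Prop where
  equivalence : Equivalence σ
  homset : ∀ x y, σ x y → P.Nab x y
  left : ∀ (a x y : S) (hx : P.rng a = P.dom x) (hy : P.rng a = P.dom y),
    σ x y → σ (P.mul a x hx) (P.mul a y hy)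
  right : ∀ (a x y : S) (hx : P.rng x = P.dom a) (hy : P.rng y = P.dom a),
    σ x y → σ (P.mul x a hx) (P.mul y a hy)

/-- The set of all congruences, ordered by inclusion (the pointwise order on relations). -/
def Cong : Set (S → S → Prop) := {σ | P.IsCongruence σ}

/-- Ideals: non-empty subsets `I` with `IS ⊆ I` and `SI ⊆ I`. -/
structure IsIdeal (I : Set S) : Prop where
  nonempty : I.Nonempty
  mul_right : ∀ (x s : S) (h : P.rng x = P.dom s), x ∈ I → P.mul x s h ∈ I
  mul_left : ∀ (s x : S) (h : P.rng s = P.dom x), x ∈ I → P.mul s x h ∈ I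

/-- The partial semigroup structure on a subset closed under products, with the same objects. -/
def restrict (I : Set S)
    (hI : ∀ (x y : S) (h : P.rng x = P.dom y), x ∈ I → y ∈ I → P.mul x y h ∈ I) :
    PartialSemigroup C I where
  dom x := P.dom x
  rng x := P.rng x
  mul x y h := ⟨P.mul x y h, hI x y h x.2 y.2⟩
  dom_mul x y h := P.dom_mul x y h
  rng_mul x y h := P.rng_mul x y h
  mul_assoc x y z hxy hyz := Subtype.ext (P.mul_assoc x y z hxy hyz)

/-- `P.LeftProd a x z` says `z = a · x`, where `a` lies in `S¹`: it is either an element of `S` or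
(as `none`) the identity at the domain of `x`. -/
def LeftProd : Option S → S → S → Prop
  | none, x, z => z = x
  | some a, x, z => ∃ h : P.rng a = P.dom x, z = P.mul a x h

/-- `P.RightProd x b z` says `z = x · b`, where `b` lies in `S¹`. -/
def RightProd : S → Option S → S → Prop
  | x, none, z => z = x
  | x, some b, z => ∃ h : P.rng x = P.dom b, z = P.mul x b h

/-- `P.Sandwich a x b z` says `z = a x b`, where `a` and `b` lie in `S¹`. -/
def Sandwich (a : Option S) (x : S) (b : Option S) (z : S) : Prop :=
  ∃ t, P.LeftProd a x t ∧ P.RightProd t b z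

/-- The principal ideal `S¹ x S¹`. -/
def principal (x : S) : Set S := {z | ∃ a b, P.Sandwich a x b z}

/-- Green's `J`-relation. -/
def GreenJ (x y : S) : Prop := P.principal x = P.principal y

/-- The Rees congruence of an ideal `I`. -/
def Rees (I : Set S) (x y : S) : Prop := x = y ∨ (x ∈ I ∧ y ∈ I ∧ P.Nab x y)

/-- The relation `ν_N = {(axb, ayb) : x, y ∈ N, a, b ∈ S¹, axb, ayb ∈ D}`, where `D` is the
`J`-class containing `N` (here `N` is contained in a single `J`-class). -/
def Nu (N : Set S) (z w : S) : Prop :=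
  ∃ x ∈ N, ∃ y ∈ N, ∃ a b, P.Sandwich a x b z ∧ P.Sandwich a y b w ∧
    P.GreenJ z x ∧ P.GreenJ w y

/-- The relation `R_{I,N} = R_I ∪ ν_N`. -/
def ReesNu (I N : Set S) (x y : S) : Prop := P.Rees I x y ∨ P.Nu N x y

/-- Isomorphisms of partial semigroups over the same objects. -/
structure Iso {T : Type w} (Q : PartialSemigroup C T) extends S ≃ T where
  dom_eq : ∀ x, Q.dom (toFun x) = P.dom x
  rng_eq : ∀ x, Q.rng (toFun x) = P.rng x
  map_mul : ∀ (x y : S) (h : P.rng x = P.dom y) (h' : Q.rng (toFun x) = Q.dom (toFun y)),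
    toFun (P.mul x y h) = Q.mul (toFun x) (toFun y) h'

end General

/-- The partial rectangular band on `X × Y`, where `X = ⋃ X_A` and `Y = ⋃ Y_A` are disjoint unions
over the objects `A`; the product is `(x₁, y₁) · (x₂, y₂) = (x₁, y₂)`. -/
def rectBand {C : Type u} (X Y : C → Type v) :
    PartialSemigroup C ((Σ A, X A) × (Σ A, Y A)) where
  dom p := p.1.1
  rng p := p.2.1
  mul p q _ := (p.1, q.2)
  dom_mul _ _ _ := rfl
  rng_mul _ _ _ := rfl
  mul_assoc _ _ _ _ _ := rfl

/-- The relation on `X × Y` given by families of equivalences on the sets `X_A` and `Y_A`. -/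
def rectRel {C : Type u} {X Y : C → Type v} (E₁ : ∀ A, Setoid (X A)) (E₂ : ∀ A, Setoid (Y A))
    (p q : (Σ A, X A) × (Σ A, Y A)) : Prop :=
  ∃ (A B : C) (x₁ x₂ : X A) (y₁ y₂ : Y B),
    p = (⟨A, x₁⟩, ⟨B, y₁⟩) ∧ q = (⟨A, x₂⟩, ⟨B, y₂⟩) ∧ (E₁ A).r x₁ x₂ ∧ (E₂ B).r y₁ y₂

end PartialSemigroup

/-- A morphism `(A, α, B)`, with `α` a map from the set `X A` to the set `X B`. -/
structure TransMor {ι : Type u} (X : ι → Type v) where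
  dom : ι
  rng : ι
  map : X dom → X rng

/-- The transformation category of a family of sets: all maps between them, composed from left to
right. -/
def transCat {ι : Type u} (X : ι → Type v) : PartialSemigroup ι (TransMor X) where
  dom := TransMor.dom
  rng := TransMor.rng
  mul x y h := ⟨x.dom, y.rng, fun a => y.map (cast (congrArg X h) (x.map a))⟩
  dom_mul _ _ _ := rfl
  rng_mul _ _ _ := rfl
  mul_assoc _ _ _ _ _ := rfl

/-- The rank of a map: the size of its image. -/
noncomputable def TransMor.rank {ι : Type u} {X : ι → Type v} (α : TransMor X) : ℕ :=
  (Set.range α.map).ncard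

/-- The set `I_r` of all maps of rank at most `r`; `I_ω` is the case `r = ⊤`. -/
def transIdealSet {ι : Type u} (X : ι → Type v) (r : ℕ∞) : Set (TransMor X) :=
  {α | (α.rank : ℕ∞) ≤ r}

theorem transIdealSet_mul {ι : Type u} (X : ι → Type v) [∀ i, Finite (X i)] (r : ℕ∞)
    (x y : TransMor X) (h : (transCat X).rng x = (transCat X).dom y)
    (_ : x ∈ transIdealSet X r) (hy : y ∈ transIdealSet X r) :
    (transCat X).mul x y h ∈ transIdealSet X r := by
  have hle : ((transCat X).mul x y h).rank ≤ y.rank := by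
    refine Set.ncard_le_ncard ?_ (Set.toFinite _)
    rintro _ ⟨a, rfl⟩
    exact ⟨_, rfl⟩
  have hy' : (y.rank : ℕ∞) ≤ r := hy
  exact le_trans (Nat.cast_le.2 hle) hy'

/-- `I_r` as a partial semigroup. -/
def transIdeal {ι : Type u} (X : ι → Type v) [∀ i, Finite (X i)] (r : ℕ∞) :
    PartialSemigroup ι (transIdealSet X r) :=
  (transCat X).restrict (transIdealSet X r) (transIdealSet_mul X r)

/-- The parameter `ξ`: the least strict upper bound of the sizes of the (finite) sets `X i`,
with `⊤` standing for `ω`. -/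
noncomputable def xi {ι : Type u} (X : ι → Type v) : ℕ∞ :=
  sInf {k : ℕ∞ | ∀ i, (Nat.card (X i) : ℕ∞) < k}

/-- For a permutation `π` of `{0, …, q}`, the map `π♮` on the set `Y`, whose elements are enumerated
as `e 0, …, e (n-1)` with `n > q`: it sends `e k` to `e (π k)` for `k < q`, and `e k` to `e (π q)`
for `k ≥ q`. -/
def natPerm {Y : Type v} {n q : ℕ} (e : Fin n ≃ Y) (h : q + 1 ≤ n) (π : Equiv.Perm (Fin (q + 1)))
    (y : Y) : Y :=
  e (Fin.castLE h (π ⟨min (e.symm y : ℕ) q, Nat.lt_succ_of_le (min_le_right _ _)⟩))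

/-- The set `N♮ = {π♮ : π ∈ N}` of endomorphisms of the object `A`, as a subset of `I_r`. -/
def natSet {ι : Type u} (X : ι → Type v) (r : ℕ∞) {q n : ℕ} (A : ι) (e : Fin n ≃ X A)
    (N : Subgroup (Equiv.Perm (Fin (q + 1)))) : Set (transIdealSet X r) :=
  {α | ∃ (h : q + 1 ≤ n) (π : Equiv.Perm (Fin (q + 1))), π ∈ N ∧
    (α : TransMor X) = ⟨A, A, natPerm e h π⟩}

/-!
The minimum ideal `I_1` consists of the constant maps, and a constant map is determined by its
domain and its value. So `I_1` is a partial rectangular band, one of whose two families of sets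
consists of one-point sets. In any partial rectangular band `(x, y) = (x, y₀) (x₀, y)`, so a
congruence is determined by what it does on each coordinate separately
(`IsCongruence.exists_rectRel`, `rectBandCongOrderIso`).

Let `σ` be a congruence on `I_r`, `r ≥ 2`, other than equality. Then `σ` relates any two parallel
constant maps. If `σ` relates `f` and `g`, and `f` is injective on a set of `s` points on which `g`
is not, then every map `θ` of rank between `2` and `s` can be written as `b ∘ f ∘ a` with `b ∘ g ∘ a`
of smaller rank; by induction `θ` is related to a constant map, so that `σ` collapses all of `I_s`
(`collapses_of_injective_of_not_injective`). The same holds if `f` is injective on the set and `g`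
sends one of its points outside the `f`-image (`collapses_of_notMem_range`), as composition with
a suitable retraction leads back to the first case.

Let `q` be maximal such that `I_q` is collapsed. If `q` does not exist, `σ` is universal.
Otherwise a related pair of distinct maps, not both in `I_q`, must by these two facts consist
of maps that differ by a permutation of their common image (`exists_perm_of_not_collapses`). This
image has exactly `q + 1` points, since for such a pair the ideal of next smaller rank is collapsed
too (`collapses_of_perm`). The permutations that arise form a normal subgroup `N` of `S_{q+1}`, and
`σ = R_{I_q, N}` (`eq_or_exists_reesPerm`). That every `R_{I_q, N}` is a congruence is a direct
check in terms of factorizations of maps through `Fin (q + 1)`, where normality makes the relation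
independent of the factorization. These relations form a chain because the normal subgroups of a
finite symmetric group do (`Equiv.Perm.normal_le_or_le`).
-/

/-! ### Normal subgroups of symmetric groups -/

namespace Equiv.Perm

theorem eq_alternatingGroup_or_eq_top {n : ℕ} {N : Subgroup (Perm (Fin n))}
    (h : alternatingGroup (Fin n) ≤ N) : N = alternatingGroup (Fin n) ∨ N = ⊤ := by
  by_cases hN : N ≤ alternatingGroup (Fin n)
  · exact Or.inl (le_antisymm hN h)
  · right
    obtain ⟨t, htN, ht⟩ := SetLike.not_le_iff_exists.1 hN
    rw [mem_alternatingGroup] at ht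
    have ht' : sign t = -1 := (Int.units_eq_one_or _).resolve_left ht
    refine eq_top_iff.2 fun g _ => ?_
    rcases Int.units_eq_one_or (sign g) with hg | hg
    · exact h (mem_alternatingGroup.2 hg)
    · have : t⁻¹ * g ∈ N := h (mem_alternatingGroup.2 (by simp [ht', hg]))
      simpa using N.mul_mem htN this

theorem le_or_le_of_alternatingGroup_le {n : ℕ} {N M : Subgroup (Perm (Fin n))}
    (hN : alternatingGroup (Fin n) ≤ N) (hM : alternatingGroup (Fin n) ≤ M) : N ≤ M ∨ M ≤ N := by
  rcases eq_alternatingGroup_or_eq_top hN with rfl | rfl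
  · exact Or.inl hM
  · exact Or.inr le_top

/-- A normal subgroup with a `3`-cycle has them all, and these generate the alternating group. -/
theorem alternatingGroup_le_of_threeCycle_mem {n : ℕ} {N : Subgroup (Perm (Fin n))}
    (hN : N.Normal) {t : Perm (Fin n)} (ht : t.IsThreeCycle) (htN : t ∈ N) :
    alternatingGroup (Fin n) ≤ N := by
  rw [← closure_three_cycles_eq_alternating, Subgroup.closure_le]
  intro g hg
  have hg' : g.IsThreeCycle := hg
  obtain ⟨c, hc⟩ := isConj_iff.1 (isConj_of_cycleType_eq (ht.trans hg'.symm))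
  exact hc ▸ hN.conj_mem t htN c

/-- The product of `g` with one of its conjugates lies in every normal subgroup that contains `g`, so
this recovers the alternating group as soon as such a product moves exactly three points. -/
theorem alternatingGroup_le_of_three_support {n : ℕ} {N : Subgroup (Perm (Fin n))}
    (hN : N.Normal) {g : Perm (Fin n)} (hg : g ∈ N)
    (h : ∃ c : Perm (Fin n), (g * (c * g * c⁻¹)).support.card = 3) :
    alternatingGroup (Fin n) ≤ N := by
  obtain ⟨c, hc⟩ := h
  exact alternatingGroup_le_of_threeCycle_mem hN (card_support_eq_three_iff.1 hc)
    (N.mul_mem hg (hN.conj_mem g hg c))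

theorem three_support_of_fin_three : ∀ g : Perm (Fin 3), g ≠ 1 →
    ∃ c : Perm (Fin 3), (g * (c * g * c⁻¹)).support.card = 3 := by
  decide

set_option maxRecDepth 100000 in
/-- An element of `S_4` is trivial or a product of two disjoint transpositions, or else its product
with one of its conjugates is a `3`-cycle. -/
theorem fin_four_trichotomy : ∀ g : Perm (Fin 4), g = 1 ∨
    (∃ c : Perm (Fin 4), c * (swap 0 1 * swap 2 3) * c⁻¹ = g) ∨
    ∃ c : Perm (Fin 4), (g * (c * g * c⁻¹)).support.card = 3 := by
  decide

theorem normal_le_or_le_fin_four {N M : Subgroup (Perm (Fin 4))} (hN : N.Normal) (hM : M.Normal) :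
    N ≤ M ∨ M ≤ N := by
  set v : Perm (Fin 4) := swap 0 1 * swap 2 3
  have key : ∀ K : Subgroup (Perm (Fin 4)), K.Normal → alternatingGroup (Fin 4) ≤ K ∨
      ∀ g ∈ K, g = 1 ∨ ∃ c : Perm (Fin 4), c * v * c⁻¹ = g := by
    intro K hK
    by_contra! h
    obtain ⟨h1, g, hg, hg1, hgv⟩ := h
    rcases fin_four_trichotomy g with h | ⟨c, hc⟩ | h
    · exact hg1 h
    · exact hgv c hc
    · exact h1 (alternatingGroup_le_of_three_support hK hg h)
  -- A normal subgroup inside the Klein four-group is below every normal subgroup containing `v`.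
  have below : ∀ K L : Subgroup (Perm (Fin 4)), L.Normal → v ∈ L →
      (∀ g ∈ K, g = 1 ∨ ∃ c : Perm (Fin 4), c * v * c⁻¹ = g) → K ≤ L := by
    intro K L hL hvL h g hg
    rcases h g hg with rfl | ⟨c, rfl⟩
    · exact L.one_mem
    · exact hL.conj_mem v hvL c
  have hvA : v ∈ alternatingGroup (Fin 4) := by
    rw [mem_alternatingGroup]; decide
  rcases key N hN with h1 | h1 <;> rcases key M hM with h2 | h2
  · exact le_or_le_of_alternatingGroup_le h1 h2
  · exact Or.inr (below M N hN (h1 hvA) h2)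
  · exact Or.inl (below N M hM (h2 hvA) h1)
  · by_cases hvM : v ∈ M
    · exact Or.inl (below N M hM hvM h1)
    · refine Or.inr fun g hg => ?_
      rcases h2 g hg with rfl | ⟨c, rfl⟩
      · exact N.one_mem
      · refine absurd ?_ hvM
        have := hM.conj_mem _ hg c⁻¹
        simpa [mul_assoc] using this

/-- The normal subgroups of a finite symmetric group form a chain. -/
theorem normal_le_or_le {n : ℕ} {N M : Subgroup (Perm (Fin n))} (hN : N.Normal) (hM : M.Normal) :
    N ≤ M ∨ M ≤ N := by
  rcases Nat.lt_or_ge n 3 with h | h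
  · have hA : alternatingGroup (Fin n) = ⊥ :=
      alternatingGroup.eq_bot_of_card_le_two (by rw [Nat.card_fin]; omega)
    exact le_or_le_of_alternatingGroup_le (hA ▸ bot_le) (hA ▸ bot_le)
  by_cases h4 : n = 4
  · subst h4
    exact normal_le_or_le_fin_four hN hM
  have key : ∀ K : Subgroup (Perm (Fin n)), K.Normal → K = ⊥ ∨ alternatingGroup (Fin n) ≤ K := by
    intro K hK
    rcases K.bot_or_nontrivial with h0 | h0
    · exact Or.inl h0
    right
    by_cases h3 : n = 3
    · subst h3
      obtain ⟨g, hg, hg1⟩ := K.nontrivial_iff_exists_ne_one.1 h0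
      exact alternatingGroup_le_of_three_support hK hg (three_support_of_fin_three g hg1)
    · exact alternatingGroup_le_of_normal (by rw [Nat.card_fin]; omega) h0
  rcases key N hN with rfl | h1
  · exact Or.inl bot_le
  rcases key M hM with rfl | h2
  · exact Or.inr bot_le
  exact le_or_le_of_alternatingGroup_le h1 h2

end Equiv.Perm

/-! ### Ranks of maps between finite sets -/

/-- The rank of a map, that is, the number of points in its image. -/
noncomputable def mapRank {α : Type*} {β : Type*} (f : α → β) : ℕ := (Set.range f).ncard

section MapRank

variable {α β γ : Type*}

theorem mapRank_comp_le_left [Finite γ] (h : β → γ) (f : α → β) : mapRank (h ∘ f) ≤ mapRank h :=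
  Set.ncard_le_ncard (Set.range_comp_subset_range f h) (Set.toFinite _)

theorem mapRank_comp_le_right [Finite β] (h : β → γ) (f : α → β) :
    mapRank (h ∘ f) ≤ mapRank f := by
  rw [mapRank, Set.range_comp]
  exact Set.ncard_image_le (Set.toFinite _)

theorem mapRank_le_card [Finite α] (f : α → β) : mapRank f ≤ Nat.card α := by
  rw [mapRank, ← Nat.card_coe_set_eq]
  exact Finite.card_range_le f

theorem mapRank_of_injective {f : α → β} (hf : Function.Injective f) :
    mapRank f = Nat.card α := by
  rw [mapRank, ← Nat.card_coe_set_eq, Nat.card_range_of_injective hf]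

theorem injective_of_card_le_mapRank [Finite α] {f : α → β} (h : Nat.card α ≤ mapRank f) :
    Function.Injective f := by
  have hs : Function.Surjective (Set.rangeFactorization f) := Set.rangeFactorization_surjective
  have hb := (Nat.bijective_iff_surjective_and_card (Set.rangeFactorization f)).2
    ⟨hs, le_antisymm (by rwa [Nat.card_coe_set_eq]) (by
      rw [Nat.card_coe_set_eq]; exact mapRank_le_card f)⟩
  intro x y hxy
  exact hb.1 (Subtype.ext hxy)

theorem mapRank_lt_card [Finite α] {f : α → β} (h : ¬ Function.Injective f) :
    mapRank f < Nat.card α :=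
  lt_of_not_ge fun h' => h (injective_of_card_le_mapRank h')

theorem mapRank_of_surjective {f : α → β} (hf : Function.Surjective f) :
    mapRank f = Nat.card β := by
  rw [mapRank, hf.range_eq, Set.ncard_univ]

theorem surjective_of_card_le_mapRank [Finite β] {f : α → β} (h : Nat.card β ≤ mapRank f) :
    Function.Surjective f := by
  rw [← Set.range_eq_univ]
  exact Set.eq_of_subset_of_ncard_le (Set.subset_univ _) (by rwa [Set.ncard_univ])

theorem mapRank_inj_comp_surj {h : β → γ} {f : α → β} (hh : Function.Injective h)
    (hf : Function.Surjective f) : mapRank (h ∘ f) = Nat.card β := by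
  rw [mapRank, hf.range_comp, ← mapRank, mapRank_of_injective hh]

theorem mapRank_const_le (α : Type*) (b : β) : mapRank (fun _ : α => b) ≤ 1 := by
  refine (Set.ncard_le_ncard (t := {b}) ?_ (Set.finite_singleton b)).trans
    (Set.ncard_singleton b).le
  rintro _ ⟨_, rfl⟩
  rfl

theorem exists_eq_const_of_mapRank_le_one [Finite β] [Nonempty α] {f : α → β}
    (h : mapRank f ≤ 1) : ∃ b, f = fun _ => b := by
  obtain ⟨x⟩ := ‹Nonempty α›
  refine ⟨f x, funext fun y => ?_⟩
  exact (Set.ncard_le_one_iff (Set.toFinite _)).1 h ⟨y, rfl⟩ ⟨x, rfl⟩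

/-- A map of rank `n` factors through `Fin n` as a surjection followed by an injection. -/
theorem exists_factor_of_mapRank_eq [Finite β] {f : α → β} {n : ℕ} (h : mapRank f = n) :
    ∃ (a : α → Fin n) (g : Fin n → β), Function.Surjective a ∧ Function.Injective g ∧
      f = g ∘ a := by
  have e : Set.range f ≃ Fin n :=
    Finite.equivFinOfCardEq (by rw [Nat.card_coe_set_eq]; exact h)
  refine ⟨e ∘ Set.rangeFactorization f, Subtype.val ∘ e.symm,
    e.surjective.comp Set.rangeFactorization_surjective,
    Subtype.val_injective.comp e.symm.injective, ?_⟩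
  funext x
  simp [Set.rangeFactorization]

/-- An injection between finite sets can be chosen to send two given points to two given points. -/
theorem exists_injective_map_pair [Finite α] [Finite β] (h : Nat.card α ≤ Nat.card β)
    {x y : α} (hxy : x ≠ y) {x' y' : β} (hxy' : x' ≠ y') :
    ∃ ψ : α → β, Function.Injective ψ ∧ ψ x = x' ∧ ψ y = y' := by
  classical
  obtain ⟨ψ, hψ⟩ : ∃ ψ : α → β, Function.Injective ψ :=
    ⟨(Finite.equivFin β).symm ∘ Fin.castLE h ∘ Finite.equivFin α,
      (Finite.equivFin β).symm.injective.comp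
        ((Fin.castLE_injective h).comp (Finite.equivFin α).injective)⟩
  have hz : Equiv.swap (ψ x) x' (ψ y) ≠ x' := fun hc =>
    hxy (hψ ((Equiv.swap (ψ x) x').injective
      (hc.trans (Equiv.swap_apply_left (ψ x) x').symm))).symm
  refine ⟨fun a => Equiv.swap (Equiv.swap (ψ x) x' (ψ y)) y' (Equiv.swap (ψ x) x' (ψ a)),
    fun a b hab => hψ ((Equiv.swap _ _).injective ((Equiv.swap _ _).injective hab)),
    ?_, Equiv.swap_apply_left _ _⟩
  simp only [Equiv.swap_apply_left]
  exact Equiv.swap_apply_of_ne_of_ne hz.symm hxy'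

/-- Two factorizations of a map as a surjection onto `β` followed by an injection differ by a
permutation of `β`. -/
theorem exists_perm_of_comp_eq_comp [Finite β] {a a' : α → β} {g g' : β → γ}
    (ha : Function.Surjective a) (hg : Function.Injective g)
    (hg' : Function.Injective g') (h : g ∘ a = g' ∘ a') :
    ∃ ρ : Equiv.Perm β, a' = ρ ∘ a ∧ g = g' ∘ ρ := by
  obtain ⟨s, hs⟩ := ha.hasRightInverse
  have hga : ∀ x, g (a x) = g' (a' x) := fun x => congrFun h x
  have hgs : ∀ k, g k = g' (a' (s k)) := fun k => by rw [← hga, hs]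
  have hinj : Function.Injective (a' ∘ s) := fun i j hij =>
    hg (by rw [hgs, hgs]; exact congrArg g' hij)
  refine ⟨Equiv.ofBijective (a' ∘ s) (Finite.injective_iff_bijective.1 hinj), ?_, funext hgs⟩
  funext x
  exact hg' (by rw [← hga]; exact hgs (a x))

end MapRank

/-! ### Relations on the ideals of a transformation category -/

namespace PartialSemigroup

section Basic

variable {C : Type u} {S : Type v} (P : PartialSemigroup C S)

theorem isCongruence_eq : P.IsCongruence fun x y => x = y where
  equivalence := eq_equivalence
  homset := by rintro x _ rfl; exact ⟨rfl, rfl⟩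
  left := by rintro a x _ _ _ rfl; rfl
  right := by rintro a x _ _ _ rfl; rfl

theorem isCongruence_nab : P.IsCongruence P.Nab where
  equivalence := ⟨fun _ => ⟨rfl, rfl⟩, fun h => ⟨h.1.symm, h.2.symm⟩,
    fun h h' => ⟨h.1.trans h'.1, h.2.trans h'.2⟩⟩
  homset := fun _ _ h => h
  left := fun a x y hx hy h => by
    simpa [Nab, dom_mul, rng_mul] using h.2
  right := fun a x y hx hy h => by
    simpa [Nab, dom_mul, rng_mul] using h.1

end Basic

end PartialSemigroup

open PartialSemigroup

section Relations

variable {ι : Type u} {X : ι → Type v} {r : ℕ∞}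

/-- The relation that `σ` induces on the maps `X A → X B` of rank at most `r`. -/
def MapRel (σ : transIdealSet X r → transIdealSet X r → Prop) {A B : ι} (f g : X A → X B) : Prop :=
  ∃ (hf : (⟨A, B, f⟩ : TransMor X) ∈ transIdealSet X r)
    (hg : (⟨A, B, g⟩ : TransMor X) ∈ transIdealSet X r), σ ⟨⟨A, B, f⟩, hf⟩ ⟨⟨A, B, g⟩, hg⟩

theorem mem_transIdealSet {A B : ι} {f : X A → X B} :
    (⟨A, B, f⟩ : TransMor X) ∈ transIdealSet X r ↔ (mapRank f : ℕ∞) ≤ r := Iff.rfl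

theorem mem_transIdealSet_natCast {A B : ι} {f : X A → X B} {q : ℕ} :
    (⟨A, B, f⟩ : TransMor X) ∈ transIdealSet X q ↔ mapRank f ≤ q :=
  mem_transIdealSet.trans Nat.cast_le

/-- The relation on `I_r` that is given by `R` on each hom-set. -/
def liftRel (R : ∀ A B : ι, (X A → X B) → (X A → X B) → Prop)
    (x y : transIdealSet X r) : Prop :=
  ∃ (A B : ι) (f g : X A → X B), x.1 = ⟨A, B, f⟩ ∧ y.1 = ⟨A, B, g⟩ ∧ R A B f g

theorem liftRel_mk {R : ∀ A B : ι, (X A → X B) → (X A → X B) → Prop} {A B : ι}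
    {f g : X A → X B} (hf : (⟨A, B, f⟩ : TransMor X) ∈ transIdealSet X r)
    (hg : (⟨A, B, g⟩ : TransMor X) ∈ transIdealSet X r) :
    liftRel R ⟨⟨A, B, f⟩, hf⟩ ⟨⟨A, B, g⟩, hg⟩ ↔ R A B f g := by
  constructor
  · rintro ⟨A', B', f', g', h1, h2, h⟩
    cases h1
    cases h2
    exact h
  · exact fun h => ⟨A, B, f, g, rfl, rfl, h⟩

theorem mapRel_liftRel {R : ∀ A B : ι, (X A → X B) → (X A → X B) → Prop} {A B : ι}
    {f g : X A → X B} : MapRel (liftRel (r := r) R) f g ↔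
      (mapRank f : ℕ∞) ≤ r ∧ (mapRank g : ℕ∞) ≤ r ∧ R A B f g :=
  ⟨fun ⟨hf, hg, h⟩ => ⟨hf, hg, (liftRel_mk hf hg).1 h⟩,
    fun ⟨hf, hg, h⟩ => ⟨hf, hg, (liftRel_mk hf hg).2 h⟩⟩

variable [∀ i, Finite (X i)]

/-- Relations within hom-sets are determined by what they do on each hom-set. -/
theorem le_of_mapRel {σ τ : transIdealSet X r → transIdealSet X r → Prop}
    (hσ : ∀ x y, σ x y → (transIdeal X r).Nab x y)
    (h : ∀ {A B : ι} (f g : X A → X B), MapRel σ f g → MapRel τ f g) : σ ≤ τ := by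
  rintro ⟨⟨A, B, f⟩, hf⟩ ⟨⟨A', B', g⟩, hg⟩ hxy
  obtain ⟨h1, h2⟩ : A = A' ∧ B = B' := hσ _ _ hxy
  subst h1; subst h2
  exact (h f g ⟨hf, hg, hxy⟩).2.2

theorem eq_of_mapRel {σ τ : transIdealSet X r → transIdealSet X r → Prop}
    (hσ : ∀ x y, σ x y → (transIdeal X r).Nab x y)
    (hτ : ∀ x y, τ x y → (transIdeal X r).Nab x y)
    (h : ∀ {A B : ι} (f g : X A → X B), MapRel σ f g ↔ MapRel τ f g) : σ = τ :=
  le_antisymm (le_of_mapRel hσ fun f g => (h f g).1) (le_of_mapRel hτ fun f g => (h f g).2)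

theorem mapRel_nab {A B : ι} {f g : X A → X B} :
    MapRel (transIdeal X r).Nab f g ↔ (mapRank f : ℕ∞) ≤ r ∧ (mapRank g : ℕ∞) ≤ r :=
  ⟨fun h => ⟨h.1, h.2.1⟩, fun h => ⟨h.1, h.2, rfl, rfl⟩⟩

theorem liftRel_nab (R : ∀ A B : ι, (X A → X B) → (X A → X B) → Prop)
    (x y : transIdealSet X r) (h : liftRel R x y) : (transIdeal X r).Nab x y := by
  obtain ⟨A, B, f, g, h1, h2, -⟩ := h
  exact ⟨(congrArg TransMor.dom h1).trans (congrArg TransMor.dom h2).symm,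
    (congrArg TransMor.rng h1).trans (congrArg TransMor.rng h2).symm⟩

theorem isCongruence_liftRel {R : ∀ A B : ι, (X A → X B) → (X A → X B) → Prop}
    (hR : ∀ A B, Equivalence (R A B))
    (hl : ∀ {A B C : ι} (c : X A → X B) (f g : X B → X C), R B C f g → R A C (f ∘ c) (g ∘ c))
    (hr : ∀ {A B C : ι} (c : X B → X C) (f g : X A → X B), R A B f g → R A C (c ∘ f) (c ∘ g)) :
    (transIdeal X r).IsCongruence (liftRel R) where
  equivalence := by
    refine ⟨?_, ?_, ?_⟩
    · rintro ⟨⟨A, B, f⟩, hf⟩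
      exact ⟨A, B, f, f, rfl, rfl, (hR A B).refl f⟩
    · rintro x y ⟨A, B, f, g, h1, h2, h⟩
      exact ⟨A, B, g, f, h2, h1, (hR A B).symm h⟩
    · rintro x y z ⟨A, B, f, g, h1, h2, h⟩ ⟨A', B', g', k, h2', h3, h'⟩
      rw [h2] at h2'
      cases h2'
      exact ⟨A, B, f, k, h1, h3, (hR A B).trans h h'⟩
  homset := liftRel_nab R
  left := by
    rintro ⟨⟨A, B, c⟩, hc⟩ ⟨x, hx'⟩ ⟨y, hy'⟩ hx hy ⟨B', C, f, g, h1, h2, h⟩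
    dsimp only at h1 h2
    subst h1; subst h2
    obtain rfl : B = B' := hx
    exact ⟨A, C, f ∘ c, g ∘ c, rfl, rfl, hl c f g h⟩
  right := by
    rintro ⟨⟨B, C, c⟩, hc⟩ ⟨x, hx'⟩ ⟨y, hy'⟩ hx hy ⟨A, B', f, g, h1, h2, h⟩
    dsimp only at h1 h2
    subst h1; subst h2
    obtain rfl : B' = B := hx
    exact ⟨A, C, c ∘ f, c ∘ g, rfl, rfl, hr c f g h⟩

end Relations

namespace PartialSemigroup.IsCongruence

variable {ι : Type u} {X : ι → Type v} [∀ i, Finite (X i)] {r : ℕ∞}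
  {σ : transIdealSet X r → transIdealSet X r → Prop}

theorem mapRel_refl (hσ : (transIdeal X r).IsCongruence σ) {A B : ι} {f : X A → X B}
    (hf : (mapRank f : ℕ∞) ≤ r) : MapRel σ f f :=
  ⟨hf, hf, hσ.equivalence.refl _⟩

theorem mapRel_symm (hσ : (transIdeal X r).IsCongruence σ) {A B : ι} {f g : X A → X B}
    (h : MapRel σ f g) : MapRel σ g f :=
  ⟨h.2.1, h.1, hσ.equivalence.symm h.2.2⟩

theorem mapRel_trans (hσ : (transIdeal X r).IsCongruence σ) {A B : ι} {f g k : X A → X B}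
    (h : MapRel σ f g) (h' : MapRel σ g k) : MapRel σ f k :=
  ⟨h.1, h'.2.1, hσ.equivalence.trans h.2.2 h'.2.2⟩

theorem mapRel_comp_right (hσ : (transIdeal X r).IsCongruence σ) {A B C : ι} {f g : X B → X C}
    {c : X A → X B} (hc : (mapRank c : ℕ∞) ≤ r) (h : MapRel σ f g) :
    MapRel σ (f ∘ c) (g ∘ c) :=
  ⟨_, _, hσ.left ⟨⟨A, B, c⟩, hc⟩ _ _ rfl rfl h.2.2⟩

theorem mapRel_comp_left (hσ : (transIdeal X r).IsCongruence σ) {A B C : ι} {f g : X A → X B}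
    {c : X B → X C} (hc : (mapRank c : ℕ∞) ≤ r) (h : MapRel σ f g) :
    MapRel σ (c ∘ f) (c ∘ g) :=
  ⟨_, _, hσ.right ⟨⟨B, C, c⟩, hc⟩ _ _ rfl rfl h.2.2⟩

theorem mapRel_comp (hσ : (transIdeal X r).IsCongruence σ) {A B C D : ι} {f g : X B → X C}
    {c : X A → X B} {d : X C → X D} (hc : (mapRank c : ℕ∞) ≤ r) (hd : (mapRank d : ℕ∞) ≤ r)
    (h : MapRel σ f g) : MapRel σ (d ∘ f ∘ c) (d ∘ g ∘ c) :=
  hσ.mapRel_comp_left hd (hσ.mapRel_comp_right hc h)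

end PartialSemigroup.IsCongruence

/-! ### Collapsing ideals -/

section Collapse

variable {ι : Type u} {X : ι → Type v} {r : ℕ∞}

/-- The relation `σ` on `I_r` identifies any two maps of rank at most `s` in a common hom-set, that
is, `σ` contains the Rees congruence of `I_s`. -/
def Collapses (σ : transIdealSet X r → transIdealSet X r → Prop) (s : ℕ) : Prop :=
  ∀ (A B : ι) (f g : X A → X B), mapRank f ≤ s → mapRank g ≤ s → MapRel σ f g

theorem Collapses.mono {σ : transIdealSet X r → transIdealSet X r → Prop} {s t : ℕ}
    (h : Collapses σ s) (hts : t ≤ s) : Collapses σ t :=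
  fun A B f g hf hg => h A B f g (hf.trans hts) (hg.trans hts)

end Collapse

namespace PartialSemigroup.IsCongruence

variable {ι : Type u} {X : ι → Type v} [∀ i, Finite (X i)] [∀ i, Nonempty (X i)] {r : ℕ∞}
  {σ : transIdealSet X r → transIdealSet X r → Prop}

/-- A congruence other than equality identifies parallel constant maps: if `f p ≠ g p`, then any two
points `d`, `d'` are the images of `f p`, `g p` under a map of rank at most two. -/
theorem collapses_one (hσ : (transIdeal X r).IsCongruence σ) (hr : 2 ≤ r) {A B : ι}
    {f g : X A → X B} (h : MapRel σ f g) (hne : f ≠ g) : Collapses σ 1 := by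
  classical
  intro C D k l hk hl
  obtain ⟨d, rfl⟩ := exists_eq_const_of_mapRank_le_one hk
  obtain ⟨d', rfl⟩ := exists_eq_const_of_mapRank_le_one hl
  obtain ⟨p, hp⟩ := Function.ne_iff.1 hne
  let b : X B → X D := fun z => if z = f p then d else d'
  have hb : mapRank b ≤ 2 := by
    refine (Set.ncard_le_ncard (t := {d, d'}) ?_ (Set.toFinite _)).trans ?_
    swap
    · exact (Set.ncard_insert_le d {d'}).trans (by rw [Set.ncard_singleton])
    rintro _ ⟨z, rfl⟩
    by_cases hz : z = f p <;> simp [b, hz]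
  have hc : (mapRank (fun _ : X C => p) : ℕ∞) ≤ r :=
    (Nat.cast_le.2 ((mapRank_const_le (X C) p).trans one_le_two)).trans hr
  have := hσ.mapRel_comp hc ((Nat.cast_le.2 hb).trans hr) h
  have e1 : b ∘ f ∘ (fun _ : X C => p) = fun _ => d := by funext; simp [b]
  have e2 : b ∘ g ∘ (fun _ : X C => p) = fun _ => d' := by funext; simp [b, Ne.symm hp]
  rwa [e1, e2] at this

/-- If `σ` relates `f` and `g`, and `f` is injective on a set of `s` points on which `g` is not,
then `σ` collapses `I_s`: every `θ` of rank between `2` and `s` is `b ∘ f ∘ a`, with `a`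
chosen such that `b ∘ g ∘ a` has smaller rank, and so `θ` is related to a constant map. -/
theorem collapses_of_injective_of_not_injective (hσ : (transIdeal X r).IsCongruence σ)
    (hr : 2 ≤ r) {A B : ι} {f g : X A → X B} (h : MapRel σ f g) {K : Type*} [Finite K]
    (φ : K → X A) (hf : Function.Injective (f ∘ φ)) (hg : ¬ Function.Injective (g ∘ φ)) :
    Collapses σ (Nat.card K) := by
  have hKr : (Nat.card K : ℕ∞) ≤ r := by
    rw [← mapRank_of_injective hf]
    exact (Nat.cast_le.2 (mapRank_comp_le_left f φ)).trans h.1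
  have h1 : Collapses σ 1 := hσ.collapses_one hr h (by rintro rfl; exact hg hf)
  obtain ⟨x, y, hgxy, hxy⟩ : ∃ x y, g (φ x) = g (φ y) ∧ x ≠ y := by
    simpa [Function.Injective] using hg
  have toConst : ∀ (n : ℕ) (C D : ι) (θ : X C → X D), mapRank θ = n → n ≤ Nat.card K →
      ∃ d, MapRel σ θ (fun _ => d) := by
    intro n
    induction n using Nat.strong_induction_on with
    | _ n ih =>
    intro C D θ hn hnK
    have hθr : (mapRank θ : ℕ∞) ≤ r := by rw [hn]; exact (Nat.cast_le.2 hnK).trans hKr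
    rcases Nat.lt_or_ge n 2 with hn2 | hn2
    · obtain ⟨d, rfl⟩ := exists_eq_const_of_mapRank_le_one (f := θ) (by omega)
      exact ⟨d, hσ.mapRel_refl hθr⟩
    have hcard : Nat.card (Set.range θ) = n := by rw [Nat.card_coe_set_eq]; exact hn
    have : Nontrivial (Set.range θ) := Finite.one_lt_card_iff_nontrivial.1 (by omega)
    obtain ⟨x', y', hxy'⟩ := exists_pair_ne (Set.range θ)
    obtain ⟨ψ, hψ, hψx, hψy⟩ := exists_injective_map_pair (hcard.le.trans hnK) hxy' hxy
    set a : X C → X A := φ ∘ ψ ∘ Set.rangeFactorization θ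
    set b : X B → X D := Subtype.val ∘ Function.invFun (f ∘ φ ∘ ψ)
    have har : (mapRank a : ℕ∞) ≤ r := by
      refine (Nat.cast_le.2 ?_).trans hθr
      rw [hn, ← hcard, ← mapRank_of_surjective (Set.rangeFactorization_surjective (f := θ))]
      exact mapRank_comp_le_right (φ ∘ ψ) (Set.rangeFactorization θ)
    have hbr : (mapRank b : ℕ∞) ≤ r := by
      refine (Nat.cast_le.2 ?_).trans hθr
      rw [hn, ← hcard, ← mapRank_of_injective (Subtype.val_injective (p := (· ∈ Set.range θ)))]
      exact mapRank_comp_le_left _ _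
    have hfa : b ∘ f ∘ a = θ := by
      funext z
      have hinj : Function.Injective (f ∘ φ ∘ ψ) := hf.comp hψ
      have := Function.leftInverse_invFun hinj (Set.rangeFactorization θ z)
      exact congrArg Subtype.val this
    have hga : mapRank (b ∘ g ∘ a) < n := by
      have hnot : ¬ Function.Injective (b ∘ g ∘ φ ∘ ψ) := fun hi =>
        hxy' (hi (by simp only [Function.comp_apply, hψx, hψy, hgxy]))
      calc mapRank (b ∘ g ∘ a)
          = mapRank ((b ∘ g ∘ φ ∘ ψ) ∘ Set.rangeFactorization θ) := rfl
        _ ≤ mapRank (b ∘ g ∘ φ ∘ ψ) := mapRank_comp_le_left _ _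
        _ < n := hcard ▸ mapRank_lt_card hnot
    have hrel := hσ.mapRel_comp har hbr h
    rw [hfa] at hrel
    obtain ⟨d, hd⟩ := ih _ hga C D _ rfl (hga.le.trans hnK)
    exact ⟨d, hσ.mapRel_trans hrel hd⟩
  intro C D k l hk hl
  obtain ⟨d, hd⟩ := toConst _ C D k rfl hk
  obtain ⟨d', hd'⟩ := toConst _ C D l rfl hl
  exact hσ.mapRel_trans hd (hσ.mapRel_trans
    (h1 C D _ _ (mapRank_const_le _ _) (mapRank_const_le _ _)) (hσ.mapRel_symm hd'))

/-- If `σ` relates `f` and `g`, and `f` is injective on a set of `s` points, one of which `g` sends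
outside the `f`-image of the set, then `σ` collapses `I_s`: composing with a retraction onto
that `f`-image makes `g` non-injective on the set. -/
theorem collapses_of_notMem_range (hσ : (transIdeal X r).IsCongruence σ)
    (hr : 2 ≤ r) {A B : ι} {f g : X A → X B} (h : MapRel σ f g) {K : Type*} [Finite K]
    (φ : K → X A) (hf : Function.Injective (f ∘ φ)) (u : K)
    (hu : g (φ u) ∉ Set.range (f ∘ φ)) : Collapses σ (Nat.card K) := by
  classical
  by_cases hK : ∀ w, w = u
  · have : Subsingleton K := ⟨fun w w' => (hK w).trans (hK w').symm⟩
    refine (hσ.collapses_one hr h ?_).mono (Finite.card_le_one_iff_subsingleton.2 this)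
    rintro rfl
    exact hu ⟨u, rfl⟩
  push Not at hK
  obtain ⟨w, hw⟩ := hK
  -- The retraction sends all points outside the `f`-image to `c`, which is chosen such that it
  -- identifies the images of `φ u` and `φ w` under `g`.
  let c : X B := if g (φ w) ∈ Set.range (f ∘ φ) then g (φ w) else f (φ u)
  have hc : c ∈ Set.range (f ∘ φ) := by
    by_cases hgw : g (φ w) ∈ Set.range (f ∘ φ)
    · simpa only [c, if_pos hgw] using hgw
    · simp only [c, if_neg hgw]
      exact ⟨u, rfl⟩
  let b : X B → X B := fun z => if z ∈ Set.range (f ∘ φ) then z else c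
  have hb : mapRank b ≤ mapRank (f ∘ φ) := by
    refine Set.ncard_le_ncard ?_ (Set.toFinite _)
    rintro _ ⟨z, rfl⟩
    by_cases hz : z ∈ Set.range (f ∘ φ)
    · simpa only [b, if_pos hz] using hz
    · simpa only [b, if_neg hz] using hc
  have hbr : (mapRank b : ℕ∞) ≤ r :=
    (Nat.cast_le.2 (hb.trans (mapRank_comp_le_left f φ))).trans h.1
  have hbf : (b ∘ f) ∘ φ = f ∘ φ := by
    funext k
    exact if_pos ⟨k, rfl⟩
  refine hσ.collapses_of_injective_of_not_injective hr (hσ.mapRel_comp_left hbr h) φ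
    (by rwa [hbf]) fun hi => hw (hi ?_)
  have hbu : b (g (φ u)) = c := if_neg hu
  have hbw : b (g (φ w)) = c := by
    by_cases hgw : g (φ w) ∈ Set.range (f ∘ φ)
    · simp only [b, c, if_pos hgw]
    · simp only [b, if_neg hgw]
  exact hbw.trans hbu.symm

/-- If a congruence does not collapse `I_n`, then a map of rank `n` and any map related to it differ
by a permutation of their common image. -/
theorem exists_perm_of_not_collapses (hσ : (transIdeal X r).IsCongruence σ) (hr : 2 ≤ r)
    {A B : ι} {f g : X A → X B} (h : MapRel σ f g) {n : ℕ} (hn : mapRank f = n)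
    (hnc : ¬ Collapses σ n) :
    ∃ (a : X A → Fin n) (k : Fin n → X B) (π : Equiv.Perm (Fin n)), Function.Surjective a ∧
      Function.Injective k ∧ f = k ∘ a ∧ g = k ∘ π ∘ a := by
  classical
  obtain ⟨a, k, ha, hk, rfl⟩ := exists_factor_of_mapRank_eq hn
  obtain ⟨s, hs⟩ := ha.hasRightInverse
  have hnc' : ¬ Collapses σ (Nat.card (Fin n)) := by rwa [Nat.card_fin]
  have sect : ∀ p, ∃ t : Fin n → X A, Function.RightInverse t a ∧ t (a p) = p ∧
      ∀ j, j ≠ a p → t j = s j := by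
    refine fun p => ⟨Function.update s (a p) p, fun j => ?_, by simp, fun j hj => by simp [hj]⟩
    by_cases hj : j = a p
    · subst hj; simp
    · simp [hj, hs j]
  have hinj : ∀ t : Fin n → X A, Function.RightInverse t a → Function.Injective ((k ∘ a) ∘ t) :=
    fun t ht i j hij => by
      have : a (t i) = a (t j) := hk hij
      rwa [ht, ht] at this
  have hrange : ∀ p, g p ∈ Set.range k := by
    intro p
    by_contra hp
    obtain ⟨t, ht, htp, -⟩ := sect p
    refine hnc' (hσ.collapses_of_notMem_range hr h t (hinj t ht) (a p) ?_)
    rw [htp]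
    rintro ⟨j, hj⟩
    exact hp ⟨_, hj⟩
  choose b hb using hrange
  have hbinj : ∀ t : Fin n → X A, Function.RightInverse t a → Function.Injective (b ∘ t) := by
    intro t ht
    by_contra hbt
    refine hnc' (hσ.collapses_of_injective_of_not_injective hr h t (hinj t ht) fun hgt => ?_)
    refine hbt fun i j hij => hgt ?_
    change g (t i) = g (t j)
    rw [← hb, ← hb]
    exact congrArg k hij
  refine ⟨a, k, Equiv.ofBijective (b ∘ s) (Finite.injective_iff_bijective.1 (hbinj s hs)), ha, hk,
    rfl, funext fun p => ?_⟩
  change g p = k (b (s (a p)))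
  rw [← hb p]
  obtain ⟨j, hj⟩ := (Finite.injective_iff_surjective.1 (hbinj s hs)) (b p)
  change b (s j) = b p at hj
  by_cases hjp : j = a p
  · rw [← hjp, hj]
  · obtain ⟨t, ht, htp, hts⟩ := sect p
    refine absurd (hbinj t ht (a₁ := j) (a₂ := a p) ?_) hjp
    change b (t j) = b (t (a p))
    rw [htp, hts j hjp, hj]

/-- A related pair of distinct maps that differ by a permutation `π` of their common image of size
`q + 1` collapses `I_q`: if `π u ≠ u`, the two maps have different images on a
transversal of the kernel from which the point over `π u` is removed. -/
theorem collapses_of_perm (hσ : (transIdeal X r).IsCongruence σ) (hr : 2 ≤ r) {A B : ι} {q : ℕ}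
    {a : X A → Fin (q + 1)} {k : Fin (q + 1) → X B} {π : Equiv.Perm (Fin (q + 1))}
    (ha : Function.Surjective a) (hk : Function.Injective k)
    (h : MapRel σ (k ∘ a) (k ∘ π ∘ a)) (hne : π ≠ 1) : Collapses σ q := by
  obtain ⟨s, hs⟩ := ha.hasRightInverse
  obtain ⟨u, hu⟩ : ∃ u, π u ≠ u := by
    by_contra! hc
    exact hne (Equiv.ext hc)
  have hcard : Nat.card {j : Fin (q + 1) // j ≠ π u} = q := by
    rw [Nat.card_eq_fintype_card, Fintype.card_subtype_compl]
    simp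
  rw [← hcard]
  refine hσ.collapses_of_notMem_range hr h (fun j => s j.1) (fun i j hij => ?_) ⟨u, hu.symm⟩ ?_
  · have := hk hij
    rw [hs, hs] at this
    exact Subtype.ext this
  · rintro ⟨j, hj⟩
    have := hk hj
    rw [hs, Function.comp_apply, hs] at this
    exact j.2 this

end PartialSemigroup.IsCongruence

/-! ### The congruences `R_{I_q, N}` -/

section NormalRel

/-- The maps `f` and `g` have rank `q + 1` and differ by a permutation in `N` of their common image,
after some enumeration of this image as the range of an injection `k`. -/
def PermRel {q : ℕ} (N : Subgroup (Equiv.Perm (Fin (q + 1)))) {α β : Type*} (f g : α → β) : Prop :=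
  ∃ (a : α → Fin (q + 1)) (k : Fin (q + 1) → β) (π : Equiv.Perm (Fin (q + 1))),
    Function.Surjective a ∧ Function.Injective k ∧ π ∈ N ∧ f = k ∘ a ∧ g = k ∘ π ∘ a

/-- The restriction of the relation `R_{I_q, N}` to a single hom-set. -/
def ReesPermRel {q : ℕ} (N : Subgroup (Equiv.Perm (Fin (q + 1)))) {α β : Type*} (f g : α → β) :
    Prop :=
  f = g ∨ (mapRank f ≤ q ∧ mapRank g ≤ q) ∨ PermRel N f g

variable {q : ℕ} {N : Subgroup (Equiv.Perm (Fin (q + 1)))} {α β γ : Type*}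

theorem PermRel.mapRank_left {f g : α → β} (h : PermRel N f g) : mapRank f = q + 1 := by
  obtain ⟨a, k, π, ha, hk, hπ, rfl, rfl⟩ := h
  rw [mapRank_inj_comp_surj hk ha, Nat.card_fin]

theorem PermRel.symm {f g : α → β} (h : PermRel N f g) : PermRel N g f := by
  obtain ⟨a, k, π, ha, hk, hπ, rfl, rfl⟩ := h
  refine ⟨π ∘ a, k, π⁻¹, π.surjective.comp ha, hk, N.inv_mem hπ, rfl, ?_⟩
  funext x
  simp

theorem PermRel.mapRank_right {f g : α → β} (h : PermRel N f g) : mapRank g = q + 1 :=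
  h.symm.mapRank_left

/-- Normality of `N` makes the choice of enumeration immaterial. -/
theorem PermRel.trans (hN : N.Normal) {f g l : α → β} (h : PermRel N f g) (h' : PermRel N g l) :
    PermRel N f l := by
  obtain ⟨a, k, π, ha, hk, hπ, rfl, rfl⟩ := h
  obtain ⟨a', k', π', ha', hk', hπ', h1, rfl⟩ := h'
  obtain ⟨ρ, rfl, rfl⟩ := exists_perm_of_comp_eq_comp (π.surjective.comp ha) hk hk' h1
  refine ⟨a, k' ∘ ρ, (ρ⁻¹ * π' * ρ⁻¹⁻¹) * π, ha, hk, N.mul_mem (hN.conj_mem _ hπ' _) hπ, rfl, ?_⟩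
  funext x
  simp

theorem reesPermRel_equivalence (hN : N.Normal) :
    Equivalence (ReesPermRel N : (α → β) → (α → β) → Prop) where
  refl f := Or.inl rfl
  symm := by
    rintro f g (rfl | h | h)
    · exact Or.inl rfl
    · exact Or.inr (Or.inl h.symm)
    · exact Or.inr (Or.inr h.symm)
  trans := by
    rintro f g l (rfl | h | h) (rfl | h' | h')
    · exact Or.inl rfl
    · exact Or.inr (Or.inl h')
    · exact Or.inr (Or.inr h')
    · exact Or.inr (Or.inl h)
    · exact Or.inr (Or.inl ⟨h.1, h'.2⟩)
    · exact absurd h'.mapRank_left (by omega)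
    · exact Or.inr (Or.inr h)
    · exact absurd h.mapRank_right (by omega)
    · exact Or.inr (Or.inr (h.trans hN h'))

theorem ReesPermRel.comp_right [Finite β] {f g : β → γ} (h : ReesPermRel N f g)
    (c : α → β) [Finite γ] : ReesPermRel N (f ∘ c) (g ∘ c) := by
  rcases h with rfl | h | ⟨a, k, π, ha, hk, hπ, rfl, rfl⟩
  · exact Or.inl rfl
  · exact Or.inr (Or.inl ⟨(mapRank_comp_le_left _ _).trans h.1, (mapRank_comp_le_left _ _).trans h.2⟩)
  · by_cases hac : Function.Surjective (a ∘ c)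
    · exact Or.inr (Or.inr ⟨a ∘ c, k, π, hac, hk, hπ, rfl, rfl⟩)
    · have hlt : mapRank (a ∘ c) < q + 1 := lt_of_not_ge fun hge =>
        hac (surjective_of_card_le_mapRank (by rwa [Nat.card_fin]))
      refine Or.inr (Or.inl ⟨?_, ?_⟩)
      · exact (mapRank_comp_le_right k (a ∘ c)).trans (Nat.le_of_lt_succ hlt)
      · exact (mapRank_comp_le_right (k ∘ π) (a ∘ c)).trans (Nat.le_of_lt_succ hlt)

theorem ReesPermRel.comp_left [Finite β] [Finite γ] {f g : α → β} (h : ReesPermRel N f g)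
    (c : β → γ) : ReesPermRel N (c ∘ f) (c ∘ g) := by
  rcases h with rfl | h | ⟨a, k, π, ha, hk, hπ, rfl, rfl⟩
  · exact Or.inl rfl
  · exact Or.inr (Or.inl
      ⟨(mapRank_comp_le_right _ _).trans h.1, (mapRank_comp_le_right _ _).trans h.2⟩)
  · by_cases hck : Function.Injective (c ∘ k)
    · exact Or.inr (Or.inr ⟨a, c ∘ k, π, ha, hck, hπ, rfl, rfl⟩)
    · have hlt : mapRank (c ∘ k) < q + 1 := by simpa using mapRank_lt_card hck
      refine Or.inr (Or.inl ⟨?_, ?_⟩)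
      · exact (mapRank_comp_le_left (c ∘ k) a).trans (Nat.le_of_lt_succ hlt)
      · exact (mapRank_comp_le_left (c ∘ k) (π ∘ a)).trans (Nat.le_of_lt_succ hlt)

theorem ReesPermRel.mono {M : Subgroup (Equiv.Perm (Fin (q + 1)))} (hNM : N ≤ M) {f g : α → β}
    (h : ReesPermRel N f g) : ReesPermRel M f g := by
  rcases h with h | h | ⟨a, k, π, ha, hk, hπ, hf, hg⟩
  · exact Or.inl h
  · exact Or.inr (Or.inl h)
  · exact Or.inr (Or.inr ⟨a, k, π, ha, hk, hNM hπ, hf, hg⟩)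

theorem ReesPermRel.of_lt {q' : ℕ} {M : Subgroup (Equiv.Perm (Fin (q' + 1)))} (hq : q < q')
    {f g : α → β} (h : ReesPermRel N f g) : ReesPermRel M f g := by
  rcases h with h | h | h
  · exact Or.inl h
  · exact Or.inr (Or.inl (by omega))
  · exact Or.inr (Or.inl ⟨by rw [h.mapRank_left]; omega, by rw [h.mapRank_right]; omega⟩)

end NormalRel

section Classification

variable {ι : Type u} {X : ι → Type v} {r : ℕ∞}

/-- The relation `R_{I_q, N}` on `I_r`, in terms of permutations of images. -/
def reesPerm (X : ι → Type v) (r : ℕ∞) {q : ℕ} (N : Subgroup (Equiv.Perm (Fin (q + 1)))) :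
    transIdealSet X r → transIdealSet X r → Prop :=
  liftRel fun _ _ f g => ReesPermRel N f g

/-- The relations `R_{I_q, N}` form a chain, because the normal subgroups of a symmetric group
do. -/
theorem reesPerm_le_or_le {q q' : ℕ} {N : Subgroup (Equiv.Perm (Fin (q + 1)))}
    {N' : Subgroup (Equiv.Perm (Fin (q' + 1)))} (hN : N.Normal) (hN' : N'.Normal) :
    reesPerm X r N ≤ reesPerm X r N' ∨ reesPerm X r N' ≤ reesPerm X r N := by
  rcases lt_trichotomy q q' with h | rfl | h
  · exact Or.inl fun x y ⟨A, B, f, g, h1, h2, h3⟩ => ⟨A, B, f, g, h1, h2, h3.of_lt h⟩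
  · rcases Equiv.Perm.normal_le_or_le hN hN' with h | h
    · exact Or.inl fun x y ⟨A, B, f, g, h1, h2, h3⟩ => ⟨A, B, f, g, h1, h2, h3.mono h⟩
    · exact Or.inr fun x y ⟨A, B, f, g, h1, h2, h3⟩ => ⟨A, B, f, g, h1, h2, h3.mono h⟩
  · exact Or.inr fun x y ⟨A, B, f, g, h1, h2, h3⟩ => ⟨A, B, f, g, h1, h2, h3.of_lt h⟩

variable [∀ i, Finite (X i)]

theorem isCongruence_reesPerm {q : ℕ} {N : Subgroup (Equiv.Perm (Fin (q + 1)))} (hN : N.Normal) :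
    (transIdeal X r).IsCongruence (reesPerm X r N) :=
  isCongruence_liftRel (fun _ _ => reesPermRel_equivalence hN) (fun c _ _ h => h.comp_right c)
    (fun c _ _ h => h.comp_left c)

variable {σ : transIdealSet X r → transIdealSet X r → Prop}

/-- If a congruence contains one pair of maps of rank `n` differing by `π`, it contains every pair
of maps of rank `n` differing by `π`. -/
theorem PartialSemigroup.IsCongruence.mapRel_perm_transfer (hσ : (transIdeal X r).IsCongruence σ)
    {A B C D : ι} {n : ℕ} {a : X A → Fin n} {k : Fin n → X B} {π : Equiv.Perm (Fin n)}
    (ha : Function.Surjective a) (hk : Function.Injective k) (h : MapRel σ (k ∘ a) (k ∘ π ∘ a))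
    [∀ i, Nonempty (X i)] (a' : X C → Fin n) (k' : Fin n → X D) :
    MapRel σ (k' ∘ a') (k' ∘ π ∘ a') := by
  obtain ⟨s, hs⟩ := ha.hasRightInverse
  have hn : (n : ℕ∞) ≤ r := by
    have h1 : (mapRank (k ∘ a) : ℕ∞) ≤ r := h.1
    rwa [mapRank_inj_comp_surj hk ha, Nat.card_fin] at h1
  have : Nonempty (Fin n) := (inferInstance : Nonempty (X A)).map a
  have hc : (mapRank (s ∘ a') : ℕ∞) ≤ r :=
    (Nat.cast_le.2 ((mapRank_comp_le_left _ _).trans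
      ((mapRank_le_card s).trans (Nat.card_fin n).le))).trans hn
  have hd : (mapRank (k' ∘ Function.invFun k) : ℕ∞) ≤ r :=
    (Nat.cast_le.2 ((mapRank_comp_le_left _ _).trans
      ((mapRank_le_card k').trans (Nat.card_fin n).le))).trans hn
  have key := hσ.mapRel_comp hc hd h
  have hinv : ∀ j, Function.invFun k (k j) = j := Function.leftInverse_invFun hk
  have e1 : (k' ∘ Function.invFun k) ∘ (k ∘ a) ∘ (s ∘ a') = k' ∘ a' := by
    funext x; simp [hinv, hs (a' x)]
  have e2 : (k' ∘ Function.invFun k) ∘ (k ∘ π ∘ a) ∘ (s ∘ a') = k' ∘ π ∘ a' := by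
    funext x; simp [hinv, hs (a' x)]
  rwa [e1, e2] at key

/-- The permutations by which pairs of maps of rank `n` related by `σ` may differ. -/
def PartialSemigroup.IsCongruence.permSubgroup (hσ : (transIdeal X r).IsCongruence σ) {n : ℕ}
    (hn : (n : ℕ∞) ≤ r) : Subgroup (Equiv.Perm (Fin n)) where
  carrier := {π | ∀ (A B : ι) (a : X A → Fin n) (k : Fin n → X B), MapRel σ (k ∘ a) (k ∘ π ∘ a)}
  one_mem' := fun A B a k => hσ.mapRel_refl
    ((Nat.cast_le.2 ((mapRank_comp_le_left _ _).trans
      ((mapRank_le_card k).trans (Nat.card_fin n).le))).trans hn)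
  mul_mem' := fun {π ρ} hπ hρ A B a k => hσ.mapRel_trans (hρ A B a k) (hπ A B (ρ ∘ a) k)
  inv_mem' := fun {π} hπ A B a k => by
    have := hσ.mapRel_symm (hπ A B (⇑π⁻¹ ∘ a) k)
    have e : k ∘ π ∘ ⇑π⁻¹ ∘ a = k ∘ a := by funext x; simp
    rwa [e] at this

theorem PartialSemigroup.IsCongruence.permSubgroup_normal (hσ : (transIdeal X r).IsCongruence σ)
    {n : ℕ} (hn : (n : ℕ∞) ≤ r) : (hσ.permSubgroup hn).Normal where
  conj_mem := fun π hπ ρ A B a k => by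
    have := hπ A B (⇑ρ⁻¹ ∘ a) (k ∘ ρ)
    have e : (k ∘ ρ) ∘ ⇑ρ⁻¹ ∘ a = k ∘ a := by funext x; simp
    rwa [e] at this

/-- Classification of the congruences on `I_r`: a congruence other than equality and the
universal one is `R_{I_q, N}`, where `q` is maximal such that `I_q` is collapsed. -/
theorem PartialSemigroup.IsCongruence.eq_or_exists_reesPerm [∀ i, Nonempty (X i)]
    (hσ : (transIdeal X r).IsCongruence σ) (hr : 2 ≤ r) :
    (σ = fun x y => x = y) ∨ σ = (transIdeal X r).Nab ∨
      ∃ (q : ℕ) (N : Subgroup (Equiv.Perm (Fin (q + 1)))), 1 ≤ q ∧ (q : ℕ∞) < r ∧ N.Normal ∧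
        σ = reesPerm X r N := by
  by_cases hne : ∃ (A B : ι) (f g : X A → X B), MapRel σ f g ∧ f ≠ g
  swap
  · push Not at hne
    left
    refine le_antisymm (le_of_mapRel hσ.homset fun {A B} f g h => ?_) ?_
    · obtain rfl := hne A B f g h
      exact ⟨h.1, h.1, rfl⟩
    · rintro x _ rfl
      exact hσ.equivalence.refl x
  right
  obtain ⟨A₀, B₀, f₀, g₀, h₀, hne₀⟩ := hne
  have h1 : Collapses σ 1 := hσ.collapses_one hr h₀ hne₀
  by_cases hall : ∀ s : ℕ, (s : ℕ∞) ≤ r → Collapses σ s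
  · left
    refine eq_of_mapRel hσ.homset (fun _ _ h => h) fun {A B} f g => ?_
    rw [mapRel_nab]
    refine ⟨fun h => ⟨h.1, h.2.1⟩, fun h => ?_⟩
    have hm : ((max (mapRank f) (mapRank g) : ℕ) : ℕ∞) ≤ r := by
      rcases max_choice (mapRank f) (mapRank g) with e | e <;> rw [e]
      exacts [h.1, h.2]
    exact hall _ hm A B f g (le_max_left _ _) (le_max_right _ _)
  right
  classical
  push Not at hall
  have hfind := Nat.find_spec hall
  have hmin : ∀ m < Nat.find hall, (m : ℕ∞) ≤ r → Collapses σ m := fun m hm hmr => by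
    by_contra hc
    exact Nat.find_min hall hm ⟨hmr, hc⟩
  obtain ⟨q, hq⟩ : ∃ q, Nat.find hall = q + 1 := by
    refine Nat.exists_eq_succ_of_ne_zero fun h0 => hfind.2 ?_
    rw [h0]
    exact h1.mono zero_le_one
  rw [hq] at hfind hmin
  obtain ⟨hqr, hnc⟩ := hfind
  have hqr' : (q : ℕ∞) < r := lt_of_lt_of_le (Nat.cast_lt.2 q.lt_succ_self) hqr
  have hcq : Collapses σ q := hmin q q.lt_succ_self hqr'.le
  have hq1 : 1 ≤ q := by
    rcases Nat.eq_zero_or_pos q with rfl | hpos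
    · exact absurd h1 hnc
    · exact hpos
  -- A pair that is neither trivial nor in `I_q` is a permutation pair of rank exactly `q + 1`,
  -- since one of larger rank would collapse `I_{q + 1}`.
  have hforw : ∀ {A B : ι} (f g : X A → X B), MapRel σ f g → mapRank g ≤ mapRank f →
      ReesPermRel (hσ.permSubgroup hqr) f g := by
    intro A B f g h hgf
    by_cases hfg : f = g
    · exact Or.inl hfg
    by_cases hfq : mapRank f ≤ q
    · exact Or.inr (Or.inl ⟨hfq, hgf.trans hfq⟩)
    obtain ⟨m, hm⟩ : ∃ m, mapRank f = m + 1 := ⟨mapRank f - 1, by omega⟩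
    obtain ⟨a, k, π, ha, hk, rfl, rfl⟩ := hσ.exists_perm_of_not_collapses hr h hm
      fun hc => hnc (hc.mono (by omega))
    have hπ : π ≠ 1 := by rintro rfl; exact hfg rfl
    have hcm := hσ.collapses_of_perm hr ha hk h hπ
    obtain rfl : m = q := by
      by_contra hmq
      exact hnc (hcm.mono (by omega))
    exact Or.inr (Or.inr ⟨a, k, π, ha, hk, fun C D a' k' => hσ.mapRel_perm_transfer ha hk h a' k',
      rfl, rfl⟩)
  have hN := hσ.permSubgroup_normal hqr
  refine ⟨q, hσ.permSubgroup hqr, hq1, hqr', hN,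
    eq_of_mapRel hσ.homset (liftRel_nab _) fun {A B} f g => ?_⟩
  rw [reesPerm, mapRel_liftRel]
  constructor
  · intro h
    refine ⟨h.1, h.2.1, ?_⟩
    rcases le_total (mapRank g) (mapRank f) with hle | hle
    · exact hforw f g h hle
    · exact (reesPermRel_equivalence hN).symm (hforw g f (hσ.mapRel_symm h) hle)
  · rintro ⟨hf, hg, rfl | h | ⟨a, k, π, ha, hk, hπ, rfl, rfl⟩⟩
    · exact hσ.mapRel_refl hf
    · exact hcq A B f g h.1 h.2
    · exact hπ A B a k

end Classification

/-! ### Green's `J`-relation and the relations `ν_N` on `I_r` -/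

section Sandwich

variable {ι : Type u} {X : ι → Type v} [∀ i, Finite (X i)] {r : ℕ∞}

/-- Multiplying two parallel maps by the same elements of `I_r¹` on both sides amounts to composing
them with the same maps. -/
theorem exists_comp_of_sandwich {A B : ι} {f f' : X A → X B}
    {hf : (⟨A, B, f⟩ : TransMor X) ∈ transIdealSet X r}
    {hf' : (⟨A, B, f'⟩ : TransMor X) ∈ transIdealSet X r} {a b : Option (transIdealSet X r)}
    {z w : transIdealSet X r} (h : (transIdeal X r).Sandwich a ⟨⟨A, B, f⟩, hf⟩ b z)
    (h' : (transIdeal X r).Sandwich a ⟨⟨A, B, f'⟩, hf'⟩ b w) :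
    ∃ (C D : ι) (c : X C → X A) (d : X B → X D),
      z.1 = ⟨C, D, d ∘ f ∘ c⟩ ∧ w.1 = ⟨C, D, d ∘ f' ∘ c⟩ := by
  obtain ⟨t, h1, h2⟩ := h
  obtain ⟨t', h1', h2'⟩ := h'
  obtain ⟨C, c, ht, ht'⟩ : ∃ (C : ι) (c : X C → X A),
      t.1 = ⟨C, B, f ∘ c⟩ ∧ t'.1 = ⟨C, B, f' ∘ c⟩ := by
    rcases a with _ | ⟨⟨C, A', c⟩, hc⟩
    · obtain rfl : t = _ := h1
      obtain rfl : t' = _ := h1'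
      exact ⟨A, id, rfl, rfl⟩
    · obtain ⟨hA, rfl⟩ := h1
      obtain ⟨_, rfl⟩ := h1'
      obtain rfl : A' = A := hA
      exact ⟨C, c, rfl, rfl⟩
  obtain ⟨t, htm⟩ := t
  obtain ⟨t', htm'⟩ := t'
  dsimp only at ht ht'
  subst ht; subst ht'
  rcases b with _ | ⟨⟨B', D, d⟩, hd⟩
  · obtain rfl : z = _ := h2
    obtain rfl : w = _ := h2'
    exact ⟨C, B, c, id, rfl, rfl⟩
  · obtain ⟨hB, rfl⟩ := h2
    obtain ⟨_, rfl⟩ := h2'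
    obtain rfl : B = B' := hB
    exact ⟨C, D, c, d, rfl, rfl⟩

theorem sandwich_of_comp_eq {A B C D : ι} {f : X A → X B} {c : X C → X A} {d : X B → X D}
    {g : X C → X D} (hg : d ∘ f ∘ c = g)
    (hf : (⟨A, B, f⟩ : TransMor X) ∈ transIdealSet X r)
    (hc : (⟨C, A, c⟩ : TransMor X) ∈ transIdealSet X r)
    (hd : (⟨B, D, d⟩ : TransMor X) ∈ transIdealSet X r)
    (hz : (⟨C, D, g⟩ : TransMor X) ∈ transIdealSet X r) :
    (transIdeal X r).Sandwich (some ⟨_, hc⟩) ⟨_, hf⟩ (some ⟨_, hd⟩) ⟨_, hz⟩ := by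
  subst hg
  exact ⟨(transIdeal X r).mul ⟨_, hc⟩ ⟨_, hf⟩ rfl, ⟨rfl, rfl⟩, ⟨rfl, rfl⟩⟩

theorem rank_le_of_mem_principal {x z : transIdealSet X r}
    (h : z ∈ (transIdeal X r).principal x) : z.1.rank ≤ x.1.rank := by
  obtain ⟨⟨A, B, f⟩, hf⟩ := x
  obtain ⟨a, b, h⟩ := h
  obtain ⟨C, D, c, d, hz, -⟩ := exists_comp_of_sandwich h h
  rw [hz]
  exact (mapRank_comp_le_right d (f ∘ c)).trans (mapRank_comp_le_left f c)

theorem principal_subset_of_rank_eq [∀ i, Nonempty (X i)] {x y : transIdealSet X r}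
    (h : x.1.rank = y.1.rank) :
    (transIdeal X r).principal x ⊆ (transIdeal X r).principal y := by
  obtain ⟨⟨A, B, f⟩, hf⟩ := x
  obtain ⟨⟨A', B', f'⟩, hf'⟩ := y
  rintro ⟨z, hz⟩ ⟨a, b, hab⟩
  obtain ⟨C, D, c, d, hz', -⟩ := exists_comp_of_sandwich hab hab
  dsimp only at hz'
  subst hz'
  obtain ⟨n, hn⟩ : ∃ n, mapRank f = n := ⟨_, rfl⟩
  have hnr : (n : ℕ∞) ≤ r := hn ▸ hf
  have hn' : mapRank f' = n := h.symm.trans hn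
  obtain ⟨a₁, k₁, ha₁, hk₁, rfl⟩ := exists_factor_of_mapRank_eq hn
  obtain ⟨a₂, k₂, ha₂, hk₂, rfl⟩ := exists_factor_of_mapRank_eq hn'
  obtain ⟨s, hs⟩ := ha₂.hasRightInverse
  have : Nonempty (Fin n) := (inferInstance : Nonempty (X A)).map a₁
  have e : (d ∘ k₁ ∘ Function.invFun k₂) ∘ (k₂ ∘ a₂) ∘ (s ∘ a₁ ∘ c) = d ∘ (k₁ ∘ a₁) ∘ c := by
    funext p
    simp [Function.leftInverse_invFun hk₂ _, hs (a₁ (c p))]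
  have hc' : (⟨C, A', s ∘ a₁ ∘ c⟩ : TransMor X) ∈ transIdealSet X r :=
    (Nat.cast_le.2 ((mapRank_comp_le_left s (a₁ ∘ c)).trans
      ((mapRank_le_card s).trans (Nat.card_fin n).le))).trans hnr
  have hd' : (⟨B', D, d ∘ k₁ ∘ Function.invFun k₂⟩ : TransMor X) ∈ transIdealSet X r :=
    (Nat.cast_le.2 ((mapRank_comp_le_left (d ∘ k₁) (Function.invFun k₂)).trans
      ((mapRank_le_card (d ∘ k₁)).trans (Nat.card_fin n).le))).trans hnr
  exact ⟨_, _, sandwich_of_comp_eq e hf' hc' hd' hz⟩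

/-- In `I_r`, the `J`-classes are the sets of maps of a fixed rank. -/
theorem greenJ_iff_rank_eq [∀ i, Nonempty (X i)] {x y : transIdealSet X r} :
    (transIdeal X r).GreenJ x y ↔ x.1.rank = y.1.rank := by
  refine ⟨fun h => ?_, fun h => Set.Subset.antisymm (principal_subset_of_rank_eq h)
    (principal_subset_of_rank_eq h.symm)⟩
  have self : ∀ z, z ∈ (transIdeal X r).principal z := fun z => ⟨none, none, z, rfl, rfl⟩
  have h' : (transIdeal X r).principal x = (transIdeal X r).principal y := h
  exact le_antisymm (rank_le_of_mem_principal (h' ▸ self x))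
    (rank_le_of_mem_principal (h'.symm ▸ self y))

/-- The map `π♮` factors as a fixed surjection, `π`, and a fixed injection. -/
theorem exists_natPerm_factor {Y : Type v} {n q : ℕ} (e : Fin n ≃ Y) (h : q + 1 ≤ n) :
    ∃ (m : Y → Fin (q + 1)) (j : Fin (q + 1) → Y), Function.Surjective m ∧
      Function.Injective j ∧ ∀ π, natPerm e h π = j ∘ π ∘ m := by
  refine ⟨fun y => ⟨min (e.symm y : ℕ) q, Nat.lt_succ_of_le (min_le_right _ _)⟩,
    e ∘ Fin.castLE h, fun k => ⟨e (Fin.castLE h k), ?_⟩,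
    e.injective.comp (Fin.castLE_injective h), fun π => rfl⟩
  ext
  simpa using Nat.lt_succ_iff.1 k.2

/-- The relation `ν_{N♮}` relates the maps of rank `q + 1` that differ by a permutation in `N`. -/
theorem nu_iff_liftRel_permRel [∀ i, Nonempty (X i)] {q n : ℕ} (A : ι) (e : Fin n ≃ X A)
    (hqn : q + 1 ≤ n) (hqr : ((q + 1 : ℕ) : ℕ∞) ≤ r) (N : Subgroup (Equiv.Perm (Fin (q + 1))))
    (z w : transIdealSet X r) :
    (transIdeal X r).Nu (natSet X r A e N) z w ↔ liftRel (fun _ _ f g => PermRel N f g) z w := by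
  obtain ⟨m, j, hm, hj, hmj⟩ := exists_natPerm_factor e hqn
  have hrank : ∀ π : Equiv.Perm (Fin (q + 1)), mapRank (j ∘ π ∘ m) = q + 1 := fun π => by
    rw [mapRank_inj_comp_surj hj (π.surjective.comp hm), Nat.card_fin]
  constructor
  · rintro ⟨⟨x, hx⟩, ⟨_, π, hπ, rfl⟩, ⟨y, hy⟩, ⟨_, ρ, hρ, rfl⟩, a, b, h1, h2, hJ, -⟩
    obtain ⟨C, D, c, d, hz, hw⟩ := exists_comp_of_sandwich h1 h2
    rw [hmj] at hz hw
    have hzr : mapRank (d ∘ (j ∘ π ∘ m) ∘ c) = q + 1 := by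
      have h3 := greenJ_iff_rank_eq.1 hJ
      rw [hz] at h3
      exact h3.trans ((congrArg mapRank (hmj π)).trans (hrank π))
    have hdj : Function.Injective (d ∘ j) := injective_of_card_le_mapRank (by
      rw [Nat.card_fin]
      exact hzr.ge.trans (mapRank_comp_le_left (d ∘ j) (π ∘ m ∘ c)))
    have hmc : Function.Surjective (m ∘ c) := surjective_of_card_le_mapRank (by
      rw [Nat.card_fin]
      exact hzr.ge.trans (mapRank_comp_le_right (d ∘ j ∘ π) (m ∘ c)))
    refine ⟨C, D, _, _, hz, hw, π ∘ m ∘ c, d ∘ j, ρ * π⁻¹, π.surjective.comp hmc, hdj,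
      N.mul_mem hρ (N.inv_mem hπ), rfl, ?_⟩
    funext p
    simp
  · rintro ⟨C, D, f, g, hz, hw, a, k, π, ha, hk, hπ, rfl, rfl⟩
    obtain ⟨z, hzm⟩ := z
    obtain ⟨w, hwm⟩ := w
    dsimp only at hz hw
    subst hz; subst hw
    obtain ⟨s, hs⟩ := hm.hasRightInverse
    have hinv : ∀ i, Function.invFun j (j i) = i := Function.leftInverse_invFun hj
    have e1 : ∀ ρ : Equiv.Perm (Fin (q + 1)),
        (k ∘ Function.invFun j) ∘ natPerm e hqn ρ ∘ (s ∘ a) = k ∘ ρ ∘ a := by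
      intro ρ
      rw [hmj]
      funext p
      simp [hinv, hs (a p)]
    have hmem : ∀ ρ, (⟨A, A, natPerm e hqn ρ⟩ : TransMor X) ∈ transIdealSet X r := fun ρ => by
      rw [mem_transIdealSet, hmj, hrank]
      exact hqr
    have hc : (⟨C, A, s ∘ a⟩ : TransMor X) ∈ transIdealSet X r :=
      (Nat.cast_le.2 ((mapRank_comp_le_left s a).trans
        ((mapRank_le_card s).trans (Nat.card_fin _).le))).trans hqr
    have hd : (⟨A, D, k ∘ Function.invFun j⟩ : TransMor X) ∈ transIdealSet X r :=
      (Nat.cast_le.2 ((mapRank_comp_le_left k (Function.invFun j)).trans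
        ((mapRank_le_card k).trans (Nat.card_fin _).le))).trans hqr
    have key : ∀ (ρ : Equiv.Perm (Fin (q + 1)))
        (hρ : (⟨C, D, k ∘ ρ ∘ a⟩ : TransMor X) ∈ transIdealSet X r),
        (transIdeal X r).Sandwich (some ⟨_, hc⟩) ⟨_, hmem ρ⟩ (some ⟨_, hd⟩) ⟨_, hρ⟩ :=
      fun ρ hρ => sandwich_of_comp_eq (e1 ρ) (hmem ρ) hc hd hρ
    have hJ : ∀ (ρ : Equiv.Perm (Fin (q + 1)))
        (hρ : (⟨C, D, k ∘ ρ ∘ a⟩ : TransMor X) ∈ transIdealSet X r),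
        (transIdeal X r).GreenJ ⟨_, hρ⟩ ⟨_, hmem ρ⟩ := by
      intro ρ hρ
      refine greenJ_iff_rank_eq.2 ?_
      change mapRank (k ∘ ρ ∘ a) = mapRank (natPerm e hqn ρ)
      rw [hmj, hrank, mapRank_inj_comp_surj hk (ρ.surjective.comp ha), Nat.card_fin]
    exact ⟨⟨_, hmem 1⟩, ⟨hqn, 1, N.one_mem, rfl⟩, ⟨_, hmem π⟩, ⟨hqn, π, hπ, rfl⟩, _, _,
      key 1 hzm, key π hwm, hJ 1 hzm, hJ π hwm⟩

/-- The relation `R_{I_q, N♮}` does not depend on the object and the enumeration used to define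
`N♮`. -/
theorem reesNu_eq_reesPerm [∀ i, Nonempty (X i)] {q n : ℕ} (A : ι) (e : Fin n ≃ X A)
    (hqn : q + 1 ≤ n) (hqr : ((q + 1 : ℕ) : ℕ∞) ≤ r) (N : Subgroup (Equiv.Perm (Fin (q + 1)))) :
    (transIdeal X r).ReesNu (Subtype.val ⁻¹' transIdealSet X q) (natSet X r A e N) =
      reesPerm X r N := by
  funext x y
  refine propext ?_
  rw [ReesNu, nu_iff_liftRel_permRel A e hqn hqr]
  constructor
  · rintro ((rfl | ⟨hx, hy, hxy⟩) | ⟨C, D, f, g, h1, h2, h⟩)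
    · exact ⟨_, _, _, _, rfl, rfl, Or.inl rfl⟩
    · obtain ⟨⟨B, C, f⟩, hf⟩ := x
      obtain ⟨⟨B', C', g⟩, hg⟩ := y
      obtain ⟨h1, h2⟩ : B = B' ∧ C = C' := hxy
      subst h1; subst h2
      exact ⟨B, C, f, g, rfl, rfl, Or.inr (Or.inl 
        ⟨mem_transIdealSet_natCast.1 hx, mem_transIdealSet_natCast.1 hy⟩)⟩
    · exact ⟨C, D, f, g, h1, h2, Or.inr (Or.inr h)⟩
  · rintro ⟨C, D, f, g, h1, h2, h⟩
    rcases h with rfl | ⟨hf, hg⟩ | h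
    · exact Or.inl (Or.inl (Subtype.ext (h1.trans h2.symm)))
    · refine Or.inl (Or.inr ⟨?_, ?_,
        liftRel_nab (fun _ _ _ _ => True) x y ⟨C, D, f, g, h1, h2, trivial⟩⟩)
      · change x.1 ∈ transIdealSet X q
        rw [h1]
        exact mem_transIdealSet_natCast.2 hf
      · change y.1 ∈ transIdealSet X q
        rw [h2]
        exact mem_transIdealSet_natCast.2 hg
    · exact Or.inr ⟨C, D, f, g, h1, h2, h⟩

end Sandwich

/-! ### Congruences of partial rectangular bands -/

namespace PartialSemigroup

section RectBand

variable {C : Type u} {X Y : C → Type v}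

theorem rectRel_mk {E₁ : ∀ A, Setoid (X A)} {E₂ : ∀ A, Setoid (Y A)} {A B : C} {x₁ x₂ : X A}
    {y₁ y₂ : Y B} : rectRel E₁ E₂ (⟨A, x₁⟩, ⟨B, y₁⟩) (⟨A, x₂⟩, ⟨B, y₂⟩) ↔
      (E₁ A).r x₁ x₂ ∧ (E₂ B).r y₁ y₂ := by
  constructor
  · rintro ⟨A', B', x₁', x₂', y₁', y₂', h1, h2, h⟩
    cases h1
    cases h2
    exact h
  · exact fun h => ⟨A, B, x₁, x₂, y₁, y₂, rfl, rfl, h⟩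

theorem isCongruence_rectRel (E₁ : ∀ A, Setoid (X A)) (E₂ : ∀ A, Setoid (Y A)) :
    (rectBand X Y).IsCongruence (rectRel E₁ E₂) where
  equivalence := by
    refine ⟨?_, ?_, ?_⟩
    · rintro ⟨⟨A, x⟩, ⟨B, y⟩⟩
      exact rectRel_mk.2 ⟨(E₁ A).refl x, (E₂ B).refl y⟩
    · rintro p q ⟨A, B, x₁, x₂, y₁, y₂, rfl, rfl, hx, hy⟩
      exact rectRel_mk.2 ⟨(E₁ A).symm hx, (E₂ B).symm hy⟩
    · rintro p q ⟨⟨A', x₃⟩, ⟨B', y₃⟩⟩ ⟨A, B, x₁, x₂, y₁, y₂, rfl, rfl, hx, hy⟩ h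
      obtain ⟨h1, h2⟩ : A = A' ∧ B = B' := by
        obtain ⟨A'', B'', _, _, _, _, h1, h2, -⟩ := h
        cases h1
        cases h2
        exact ⟨rfl, rfl⟩
      subst h1; subst h2
      obtain ⟨hx', hy'⟩ := rectRel_mk.1 h
      exact rectRel_mk.2 ⟨(E₁ A).trans hx hx', (E₂ B).trans hy hy'⟩
  homset := by
    rintro p q ⟨A, B, x₁, x₂, y₁, y₂, rfl, rfl, -⟩
    exact ⟨rfl, rfl⟩
  left := by
    rintro ⟨⟨D, x⟩, ⟨A', y⟩⟩ p q _ _ ⟨A, B, x₁, x₂, y₁, y₂, rfl, rfl, -, hy⟩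
    exact rectRel_mk.2 ⟨(E₁ D).refl x, hy⟩
  right := by
    rintro ⟨⟨D, x⟩, ⟨A', y⟩⟩ p q _ _ ⟨A, B, x₁, x₂, y₁, y₂, rfl, rfl, hx, -⟩
    exact rectRel_mk.2 ⟨hx, (E₂ A').refl y⟩

theorem rectRel_le_iff [∀ A, Nonempty (X A)] [∀ A, Nonempty (Y A)]
    (E F : (∀ A, Setoid (X A)) × (∀ A, Setoid (Y A))) :
    rectRel E.1 E.2 ≤ rectRel F.1 F.2 ↔ E ≤ F := by
  constructor
  · intro h
    refine ⟨fun A x₁ x₂ hx => ?_, fun B y₁ y₂ hy => ?_⟩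
    · obtain ⟨y⟩ := (inferInstance : Nonempty (Y A))
      exact (rectRel_mk.1 (h (⟨A, x₁⟩, ⟨A, y⟩) (⟨A, x₂⟩, ⟨A, y⟩)
        (rectRel_mk.2 ⟨hx, (E.2 A).refl y⟩))).1
    · obtain ⟨x⟩ := (inferInstance : Nonempty (X B))
      exact (rectRel_mk.1 (h (⟨B, x⟩, ⟨B, y₁⟩) (⟨B, x⟩, ⟨B, y₂⟩)
        (rectRel_mk.2 ⟨(E.1 B).refl x, hy⟩))).2
  · rintro h p q ⟨A, B, x₁, x₂, y₁, y₂, rfl, rfl, hx, hy⟩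
    exact rectRel_mk.2 ⟨h.1 A hx, h.2 B hy⟩

/-- Every congruence `σ` of a partial rectangular band is given by families of equivalences: since
`(x, y) = (x, y₀) (x₀, y)`, it is determined by the pairs in `σ` with common second
coordinate `y₀` and those with common first coordinate `x₀`. -/
theorem IsCongruence.exists_rectRel [∀ A, Nonempty (X A)] [∀ A, Nonempty (Y A)]
    {σ : (Σ A, X A) × (Σ A, Y A) → (Σ A, X A) × (Σ A, Y A) → Prop}
    (hσ : (rectBand X Y).IsCongruence σ) :
    ∃ E : (∀ A, Setoid (X A)) × (∀ A, Setoid (Y A)), rectRel E.1 E.2 = σ := by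
  let x₀ : ∀ A, X A := fun A => Classical.arbitrary _
  let y₀ : ∀ A, Y A := fun A => Classical.arbitrary _
  refine ⟨(fun A => ⟨fun x x' => σ (⟨A, x⟩, ⟨A, y₀ A⟩) (⟨A, x'⟩, ⟨A, y₀ A⟩),
      fun _ => hσ.equivalence.refl _, hσ.equivalence.symm, hσ.equivalence.trans⟩,
    fun A => ⟨fun y y' => σ (⟨A, x₀ A⟩, ⟨A, y⟩) (⟨A, x₀ A⟩, ⟨A, y'⟩),
      fun _ => hσ.equivalence.refl _, hσ.equivalence.symm, hσ.equivalence.trans⟩), ?_⟩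
  funext p q
  refine propext ⟨?_, fun h => ?_⟩
  · rintro ⟨A, B, x₁, x₂, y₁, y₂, rfl, rfl, hx, hy⟩
    exact hσ.equivalence.trans
      (hσ.right (⟨A, x₀ A⟩, ⟨B, y₁⟩) _ _ rfl rfl hx)
      (hσ.left (⟨A, x₂⟩, ⟨B, y₀ B⟩) _ _ rfl rfl hy)
  · obtain ⟨⟨A, x₁⟩, ⟨B, y₁⟩⟩ := p
    obtain ⟨⟨A', x₂⟩, ⟨B', y₂⟩⟩ := q
    obtain ⟨h1, h2⟩ : A = A' ∧ B = B' := hσ.homset _ _ h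
    subst h1; subst h2
    exact rectRel_mk.2
      ⟨hσ.right (⟨B, x₀ B⟩, ⟨A, y₀ A⟩) (⟨A, x₁⟩, ⟨B, y₁⟩) (⟨A, x₂⟩, ⟨B, y₂⟩) rfl rfl h,
        hσ.left (⟨B, x₀ B⟩, ⟨A, y₀ A⟩) (⟨A, x₁⟩, ⟨B, y₁⟩) (⟨A, x₂⟩, ⟨B, y₂⟩) rfl rfl h⟩

/-- The lattice of congruences of a partial rectangular band. -/
noncomputable def rectBandCongOrderIso [∀ A, Nonempty (X A)] [∀ A, Nonempty (Y A)] :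
    ((∀ A, Setoid (X A)) × (∀ A, Setoid (Y A))) ≃o (rectBand X Y).Cong :=
  RelIso.ofSurjective
    (OrderEmbedding.ofMapLEIff
      (fun E => (⟨rectRel E.1 E.2, isCongruence_rectRel E.1 E.2⟩ : (rectBand X Y).Cong))
      fun E F => rectRel_le_iff E F)
    fun σ => (IsCongruence.exists_rectRel σ.2).imp fun _ h => Subtype.ext h

end RectBand

section Transport

variable {C : Type u} {S : Type v} {T : Type w} {P : PartialSemigroup C S}
  {Q : PartialSemigroup C T}

theorem Iso.isCongruence_comap_iff (e : P.Iso Q) {σ : T → T → Prop} :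
    P.IsCongruence (fun x y => σ (e.toEquiv x) (e.toEquiv y)) ↔ Q.IsCongruence σ := by
  have hsurj := e.toEquiv.surjective
  have hd : ∀ x, Q.dom (e.toEquiv x) = P.dom x := e.dom_eq
  have hr : ∀ x, Q.rng (e.toEquiv x) = P.rng x := e.rng_eq
  have hm : ∀ (x y : S) (h : P.rng x = P.dom y) (h' : Q.rng (e.toEquiv x) = Q.dom (e.toEquiv y)),
    e.toEquiv (P.mul x y h) = Q.mul (e.toEquiv x) (e.toEquiv y) h' := e.map_mul
  constructor
  · intro h
    refine ⟨⟨?_, ?_, ?_⟩, ?_, ?_, ?_⟩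
    · exact hsurj.forall.2 fun x => h.equivalence.refl x
    · intro x y
      obtain ⟨x, rfl⟩ := hsurj x
      obtain ⟨y, rfl⟩ := hsurj y
      exact fun hxy => h.equivalence.symm hxy
    · intro x y z
      obtain ⟨x, rfl⟩ := hsurj x
      obtain ⟨y, rfl⟩ := hsurj y
      obtain ⟨z, rfl⟩ := hsurj z
      exact fun hxy hyz => h.equivalence.trans hxy hyz
    · refine hsurj.forall₂.2 fun x y hxy => ?_
      have := h.homset x y hxy
      simpa only [Nab, hd, hr] using this
    · refine hsurj.forall₃.2 fun a x y hx hy hxy => ?_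
      have hx' : P.rng a = P.dom x := by rw [← hr, ← hd]; exact hx
      have hy' : P.rng a = P.dom y := by rw [← hr, ← hd]; exact hy
      have := h.left a x y hx' hy' hxy
      rwa [hm a x hx' hx, hm a y hy' hy] at this
    · refine hsurj.forall₃.2 fun a x y hx hy hxy => ?_
      have hx' : P.rng x = P.dom a := by rw [← hr, ← hd]; exact hx
      have hy' : P.rng y = P.dom a := by rw [← hr, ← hd]; exact hy
      have := h.right a x y hx' hy' hxy
      rwa [hm x a hx' hx, hm y a hy' hy] at this
  · intro h
    refine ⟨⟨fun x => h.equivalence.refl _, fun hxy => h.equivalence.symm hxy,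
      fun hxy hyz => h.equivalence.trans hxy hyz⟩, ?_, ?_, ?_⟩
    · intro x y hxy
      have := h.homset _ _ hxy
      simpa only [Nab, hd, hr] using this
    · intro a x y hx hy hxy
      have hx' : Q.rng (e.toEquiv a) = Q.dom (e.toEquiv x) := by rw [hr, hd]; exact hx
      have hy' : Q.rng (e.toEquiv a) = Q.dom (e.toEquiv y) := by rw [hr, hd]; exact hy
      rw [hm a x hx hx', hm a y hy hy']
      exact h.left _ _ _ hx' hy' hxy
    · intro a x y hx hy hxy
      have hx' : Q.rng (e.toEquiv x) = Q.dom (e.toEquiv a) := by rw [hr, hd]; exact hx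
      have hy' : Q.rng (e.toEquiv y) = Q.dom (e.toEquiv a) := by rw [hr, hd]; exact hy
      rw [hm x a hx hx', hm y a hy hy']
      exact h.right _ _ _ hx' hy' hxy

/-- Isomorphic partial semigroups have isomorphic lattices of congruences. -/
noncomputable def Iso.congOrderIso (e : P.Iso Q) : Q.Cong ≃o P.Cong :=
  RelIso.ofSurjective
    (OrderEmbedding.ofMapLEIff
      (fun σ => (⟨fun x y => σ.1 (e.toEquiv x) (e.toEquiv y),
        e.isCongruence_comap_iff.2 σ.2⟩ : P.Cong))
      fun σ τ => ⟨fun h x y hxy => by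
          have := h (e.toEquiv.symm x) (e.toEquiv.symm y)
          simp only [Equiv.apply_symm_apply] at this
          exact this hxy,
        fun h x y hxy => h _ _ hxy⟩)
    fun σ => ⟨⟨fun x y => σ.1 (e.toEquiv.symm x) (e.toEquiv.symm y),
      e.isCongruence_comap_iff.1 (by simp only [Equiv.symm_apply_apply]; exact σ.2)⟩,
      Subtype.ext (by
        funext x y
        simp [OrderEmbedding.ofMapLEIff])⟩

end Transport

end PartialSemigroup

/-! ### The minimum ideal `I_1` -/

section MinIdeal

variable {ι : Type u} {X : ι → Type v}

theorem exists_eq_const_of_mem_one [∀ i, Finite (X i)] [∀ i, Nonempty (X i)] {A B : ι}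
    {f : X A → X B} (h : (⟨A, B, f⟩ : TransMor X) ∈ transIdealSet X 1) : ∃ b, f = fun _ => b :=
  exists_eq_const_of_mapRank_le_one (mem_transIdealSet_natCast.1 (by rwa [Nat.cast_one]))

theorem const_mem_one {A B : ι} (b : X B) :
    (⟨A, B, fun _ => b⟩ : TransMor X) ∈ transIdealSet X 1 := by
  rw [← Nat.cast_one]
  exact mem_transIdealSet_natCast.2 (mapRank_const_le (X A) b)

theorem isLeast_transIdealSet_one [Nonempty ι] [∀ i, Finite (X i)] [∀ i, Nonempty (X i)] :
    IsLeast {I | (transCat X).IsIdeal I} (transIdealSet X 1) := by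
  refine ⟨⟨?_, ?_, ?_⟩, ?_⟩
  · obtain ⟨A⟩ := ‹Nonempty ι›
    exact ⟨_, const_mem_one (A := A) (Classical.arbitrary (X A))⟩
  · rintro ⟨A, B, f⟩ ⟨B', C, s⟩ h hx
    obtain ⟨b, rfl⟩ := exists_eq_const_of_mem_one hx
    obtain rfl : B = B' := h
    exact const_mem_one (s b)
  · rintro ⟨A, B, s⟩ ⟨B', C, f⟩ h hx
    obtain ⟨b, rfl⟩ := exists_eq_const_of_mem_one hx
    exact const_mem_one b
  · rintro I hI ⟨C, D, f⟩ hx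
    obtain ⟨b, rfl⟩ := exists_eq_const_of_mem_one hx
    obtain ⟨⟨A, B, f⟩, hf⟩ := hI.nonempty
    have h1 := hI.mul_left ⟨C, A, fun _ => Classical.arbitrary _⟩ _ rfl hf
    exact hI.mul_right _ ⟨B, D, fun _ => b⟩ rfl h1

/-- The minimum ideal `I_1` as a partial rectangular band: a constant map `A → B` is determined by
its domain and its value. The universe lift puts both coordinates into the same universe. -/
noncomputable def transIdealOneIso (X : ι → Type v) [∀ i, Finite (X i)] [∀ i, Nonempty (X i)] :
    (transIdeal X 1).Iso (rectBand (fun _ => PUnit.{max u v + 1})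
      (fun A => ULift.{u} (X A))) where
  toFun x := (⟨x.1.dom, ⟨⟩⟩, ⟨x.1.rng, ⟨x.1.map (Classical.arbitrary _)⟩⟩)
  invFun p := ⟨⟨p.1.1, p.2.1, fun _ => p.2.2.down⟩, const_mem_one _⟩
  left_inv := by
    rintro ⟨⟨A, B, f⟩, hx⟩
    obtain ⟨b, rfl⟩ := exists_eq_const_of_mem_one hx
    rfl
  right_inv _ := rfl
  dom_eq _ := rfl
  rng_eq _ := rfl
  map_mul := by
    rintro ⟨⟨A, B, f⟩, hx⟩ ⟨⟨B', D, g⟩, hy⟩ h h'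
    obtain ⟨b, rfl⟩ := exists_eq_const_of_mem_one hy
    rfl

/-- Universe lifting does not change the lattice of equivalence relations. -/
def setoidULiftOrderIso (α : Type v) : Setoid (ULift.{u} α) ≃o Setoid α where
  toFun s := s.comap ULift.up
  invFun s := s.comap ULift.down
  left_inv _ := rfl
  right_inv _ := rfl
  map_rel_iff' := ⟨fun h x y hxy => h (x := x.down) (y := y.down) hxy, fun h _ _ hxy => h hxy⟩

end MinIdeal

/-! ### The congruence lattices of the ideals of a transformation category -/

theorem natCast_succ_le_of_lt {q : ℕ} {r : ℕ∞} (h : (q : ℕ∞) < r) : ((q + 1 : ℕ) : ℕ∞) ≤ r := by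
  rw [Nat.cast_succ]
  exact Order.add_one_le_of_lt h

theorem theorem5 {ι : Type u} [Nonempty ι] (X : ι → Type v)
    [∀ i, Finite (X i)] [∀ i, Nonempty (X i)] :
    (IsLeast {I | (transCat X).IsIdeal I} (transIdealSet X 1) ∧
      (∃ (X' Y' : ι → Type (max u v)), (∀ A, Nonempty (X' A)) ∧ (∀ A, Nonempty (Y' A)) ∧
        ∃ (e : (transIdeal X 1).Iso (PartialSemigroup.rectBand X' Y'))
          (Φ : ((∀ A, Setoid (X' A)) × (∀ A, Setoid (Y' A))) ≃o (transIdeal X 1).Cong),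
          ∀ E x y, (Φ E).1 x y ↔
            PartialSemigroup.rectRel E.1 E.2 (e.toEquiv x) (e.toEquiv y)) ∧
      Nonempty ((transIdeal X 1).Cong ≃o (∀ A, Setoid (X A)))) ∧
    (∀ (A : ℕ → ι) (e : ∀ q, Fin (Nat.card (X (A q))) ≃ X (A q)),
      (∀ q : ℕ, 1 ≤ q → (q : ℕ∞) < xi X → q ≤ Nat.card (X (A q))) →
      ∀ r : ℕ∞, 2 ≤ r → (r < xi X ∨ (r = ⊤ ∧ xi X = ⊤)) →
        (transIdeal X r).Cong =
          {fun x y => x = y} ∪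
          {σ | ∃ (q : ℕ) (N : Subgroup (Equiv.Perm (Fin (q + 1)))),
            1 ≤ q ∧ (q : ℕ∞) < r ∧ N.Normal ∧
            σ = (transIdeal X r).ReesNu (Subtype.val ⁻¹' transIdealSet X q)
              (natSet X r (A (q + 1)) (e (q + 1)) N)} ∪
          {(transIdeal X r).Nab} ∧
        IsChain (· ≤ ·) (transIdeal X r).Cong) := by
  refine ⟨⟨isLeast_transIdealSet_one, ?_, ?_⟩, ?_⟩
  · exact ⟨_, _, fun _ => inferInstance, fun _ => inferInstance, transIdealOneIso X,
      rectBandCongOrderIso.trans (transIdealOneIso X).congOrderIso, fun _ _ _ => Iff.rfl⟩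
  · -- The first family of equivalences lives on one-point sets and carries no information.
    have : Subsingleton (Setoid PUnit.{max u v + 1}) :=
      ⟨fun s t => Setoid.ext fun a _ => iff_of_true (s.refl a) (t.refl a)⟩
    let Ψ : ((∀ _ : ι, Setoid PUnit.{max u v + 1}) × (∀ A, Setoid (ULift.{u} (X A)))) ≃o
        (∀ A, Setoid (X A)) :=
      { toFun := fun E A => setoidULiftOrderIso (X A) (E.2 A)
        invFun := fun F => (⊤, fun A => (setoidULiftOrderIso (X A)).symm (F A))
        left_inv := fun E => Prod.ext (Subsingleton.elim _ _) rfl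
        right_inv := fun F => rfl
        map_rel_iff' := fun {E F} =>
          ⟨fun h => ⟨(Subsingleton.elim E.1 F.1).le,
            fun A => (setoidULiftOrderIso (X A)).le_iff_le.1 (h A)⟩,
          fun h A => (setoidULiftOrderIso (X A)).le_iff_le.2 (h.2 A)⟩ }
    exact ⟨(rectBandCongOrderIso.trans (transIdealOneIso X).congOrderIso).symm.trans Ψ⟩
  intro A e hA r hr hrξ
  have hrees : ∀ (q : ℕ) (N : Subgroup (Equiv.Perm (Fin (q + 1)))), (q : ℕ∞) < r →
      (transIdeal X r).ReesNu (Subtype.val ⁻¹' transIdealSet X q)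
        (natSet X r (A (q + 1)) (e (q + 1)) N) = reesPerm X r N := by
    intro q N hq
    have hqr := natCast_succ_le_of_lt hq
    refine reesNu_eq_reesPerm _ _ (hA (q + 1) (Nat.le_add_left 1 q) ?_) hqr N
    rcases hrξ with h | ⟨-, h⟩
    · exact hqr.trans_lt h
    · rw [h]
      exact ENat.natCast_lt_top _
  constructor
  · ext σ
    constructor
    · intro hσ
      rcases hσ.eq_or_exists_reesPerm hr with h | h | ⟨q, N, hq, hqr, hN, h⟩
      · exact Or.inl (Or.inl h)
      · exact Or.inr h
      · exact Or.inl (Or.inr ⟨q, N, hq, hqr, hN, by rw [hrees q N hqr, h]⟩)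
    · rintro ((rfl | ⟨q, N, hq, hqr, hN, rfl⟩) | rfl)
      · exact isCongruence_eq _
      · rw [hrees q N hqr]
        exact isCongruence_reesPerm hN
      · exact isCongruence_nab _
  · intro σ hσ τ hτ _
    have bot_le : ∀ {ρ}, (transIdeal X r).IsCongruence ρ → (fun x y => x = y) ≤ ρ := by
      rintro ρ hρ x _ rfl
      exact hρ.equivalence.refl x
    rcases hσ.eq_or_exists_reesPerm hr with rfl | rfl | ⟨q, N, -, -, hN, rfl⟩
    · exact Or.inl (bot_le hτ)
    · exact Or.inr hτ.homset
    rcases hτ.eq_or_exists_reesPerm hr with rfl | rfl | ⟨q', N', -, -, hN', rfl⟩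
    · exact Or.inr (bot_le hσ)
    · exact Or.inl hσ.homset
    · exact reesPerm_le_or_le hN hN'
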